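/- **Notions.** All Hilbert spaces are complex, $L(H,K)$ denotes the bounded operators from $H$ to $K$, and $L(H)=L(H,H)$. A *quantum set* $\mathcal X$ is given by a set $\mathrm{At}(\mathcal X)$ of nonzero finite-dimensional Hilbert spaces, its *atoms*; its *dual* $\mathcal X^*$ has the dual Hilbert spaces $X^*$, $X\in \mathrm{At}(\mathcal X)$, as atoms. The von Neumann algebra $\ell^\infty(\mathcal X)=\bigoplus_{X} L(X)$ (the $\ell^\infty$-direct sum) acts on the $\ell^2$-direct sum $\bigoplus \mathrm{At}(\mathcal X)$, and $\mathrm{inc}_X$ is the inclusion isometry of the atom $X$ into this direct sum. An *operator system* in $L(H)$ is a linear subspace that contains $1$ and is closed under adjoints. A *quantum graph structure* (in Weaver's sense) on a von Neumann algebra $M\subseteq L(H)$ is an ultraweakly closed operator system $V\subseteq L(H)$ such that $m'v\in V$ and $vm'\in V$ for all $m'\in M'$ and $v\in V$. A *binary relation* $R$ on $\mathcal X$ is a choice of subspaces $R(X_1,X_2)\le L(X_1,X_2)$ for all $X_1,X_2\in\mathrm{At}(\mathcal X)$. A *relation of arity* $(\mathcal X_1,\dots,\mathcal X_n)$ is a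 choice of subspaces $P(X_1\otimes\cdots\otimes X_n)\le L(X_1\otimes\cdots\otimes X_n,\mathbb C)$ for all $X_k\in\mathrm{At}(\mathcal X_k)$. The order, meets, suprema, the largest relation $\top$ and the orthocomplement $\neg$ are taken atomwise, and $P\times Q$ is given atomwise by the tensor product of spaces of functionals. The equality relation $E_{\mathcal X}$, of arity $(\mathcal X,\mathcal X^*)$, is $\mathbb C\,\epsilon_X$ on $X\otimes X^*$, where $\epsilon_X(x\otimes\varphi)=\varphi(x)$, and $0$ on $X_1\otimes X_2^*$ for $X_1\ne X_2$. Each binary relation $R$ on $\mathcal X$ defines a relation $\hat R$ of arity $(\mathcal X,\mathcal X^*)$, where $\hat R(X_1\otimes X_2^*)$ consists of the functionals $x\otimes\varphi\mapsto\varphi(r x)$ with $r\in R(X_1,X_2)$. Formulas are built from atomic formulas $P(x_1,\dots,x_m)$, with $P$ a relation and $x_1,\dots,x_m$ distinct variables of the sorts prescribed by its arity, by $\neg$, $\wedge$ and $\forall x\in\mathcal X$. A formula $\phi$ in a context $x_1\in\mathcal X_1,\dots,x_n\in\mathcal X_n$ is interpreted as a relation $[\![\phi]\!]$ of arity $(\mathcal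 X_1,\dots,\mathcal X_n)$: an atomic formula as $P\times\top$ with its tensor factors permuted into the order of the context ($\top$ for the variables that do not occur), $\neg$ and $\wedge$ as orthocomplement and meet, and $(\forall x_1\in\mathcal X_1)\,\phi$ as $\sup\{Q : \top_{\mathcal X_1}\times Q\le[\![\phi]\!]\}$. Further, $\phi\vee\psi$ abbreviates $\neg(\neg\phi\wedge\neg\psi)$, $\phi\to\psi$ abbreviates $\neg\phi\vee(\phi\wedge\psi)$, and $(\forall(x=x_*)\in\mathcal X\times\mathcal X^*)\,\phi$ abbreviates $(\forall x_*\in\mathcal X^*)(\forall x\in\mathcal X)(E_{\mathcal X}(x,x_*)\to\phi)$. For a sentence, $[\![\phi]\!]$ is a relation of the empty arity, i.e. a subspace of $L(\mathbb C,\mathbb C)$. **Theorem.** Let $\mathcal X$ be a quantum set. There is a one-to-one correspondence between quantum graph structures $V$ on $\ell^\infty(\mathcal X)$ and binary relations $R$ on $\mathcal X$ such that 1. $[\![(\forall (x=x_*)\in\mathcal X\times\mathcal X^*)\,\hat R(x,x_*)]\!]=\top$; 2. $[\![(\forall (x_1=x_{1*})\in\mathcal X\times\mathcal X^*)\,(\forall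 (x_2=x_{2*})\in\mathcal X\times\mathcal X^*)\,(\hat R(x_1,x_{2*})\to \hat R(x_2,x_{1*}))]\!]=\top$. The correspondence is given by $R(X_1,X_2)=\mathrm{inc}_{X_2}^\dagger\cdot V\cdot\mathrm{inc}_{X_1}$ for $X_1,X_2\in\mathrm{At}(\mathcal X)$. If, furthermore, $\mathrm{At}(\mathcal X)=\{H\}$ for a single nonzero finite-dimensional Hilbert space $H$, then there is a one-to-one correspondence between operator systems $V\subseteq L(H)$ and binary relations $R$ on $\mathcal X$ that satisfy (1) and (2), given by $R(H,H)=V$. -/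

import Mathlib

open scoped ENNReal Topology

universe u v

noncomputable section

namespace QuantumLogic

/-! ### Quantum sets -/

/-- The Hilbert space structure on the dual of a Hilbert space:
`⟪φ, ψ⟫ = ⟪y, x⟫` if `φ = ⟪x, ·⟫` and `ψ = ⟪y, ·⟫`. -/
abbrev dualInnerProductSpace (E : Type v) [NormedAddCommGroup E] [InnerProductSpace ℂ E]
    [CompleteSpace E] : InnerProductSpace ℂ (StrongDual ℂ E) where
  inner φ ψ := inner ℂ ((InnerProductSpace.toDual ℂ E).symm ψ)
    ((InnerProductSpace.toDual ℂ E).symm φ)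
  norm_sq_eq_re_inner φ := by
    rw [← norm_sq_eq_re_inner, LinearIsometryEquiv.norm_map]
  conj_inner_symm φ ψ := inner_conj_symm _ _
  add_left φ ψ χ := by rw [map_add, inner_add_right]
  smul_left φ ψ c := by rw [map_smulₛₗ, inner_smul_right]

/-- A quantum set: a set of nonzero finite-dimensional complex Hilbert spaces, its atoms,
given as a family indexed by a type of labels. -/
structure QSet where
  /-- The labels of the atoms; distinct labels stand for distinct atoms. -/
  At : Type u
  atom : At → Type v
  [normed : ∀ i, NormedAddCommGroup (atom i)]
  [innerProduct : ∀ i, InnerProductSpace ℂ (atom i)]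
  [finDim : ∀ i, FiniteDimensional ℂ (atom i)]
  [nonzero : ∀ i, Nontrivial (atom i)]

attribute [instance] QSet.normed QSet.innerProduct QSet.finDim QSet.nonzero

instance (X : QSet.{u, v}) (i : X.At) : CompleteSpace (X.atom i) :=
  FiniteDimensional.complete ℂ _

/-- The dual quantum set `X*`: its atoms are the duals of the atoms of `X`. -/
def QSet.dual (X : QSet.{u, v}) : QSet.{u, v} where
  At := X.At
  atom i := StrongDual ℂ (X.atom i)
  normed _ := inferInstance
  innerProduct i := dualInnerProductSpace (X.atom i)
  finDim _ := inferInstance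
  nonzero _ := inferInstance

/-- The label of the atom of `X` whose dual has the label `j`. -/
def QSet.ofDual (X : QSet.{u, v}) (j : X.dual.At) : X.At := j

/-- A binary relation from `X` to `Y`: subspaces `R(X_i, Y_j) ≤ L(X_i, Y_j)`. -/
abbrev BinRel (X Y : QSet.{u, v}) :=
  ∀ (i : X.At) (j : Y.At), Submodule ℂ (X.atom i →L[ℂ] Y.atom j)

/-! ### Relations of a given arity -/

/-- The functionals on `X₁ ⊗ ⋯ ⊗ Xₙ`, where `X_k` is the atom with label `a k`,
given as multilinear functionals. -/
abbrev Functional {I : Type} (Γ : I → QSet.{u, v}) (a : ∀ k, (Γ k).At) :=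
  MultilinearMap ℂ (fun k => (Γ k).atom (a k)) ℂ

/-- A relation of arity `Γ = (X₁, …, Xₙ)` assigns a space of functionals on `X₁ ⊗ ⋯ ⊗ Xₙ` to each
choice of atoms. Order, `⊤`, meets and suprema are those of subspaces, taken atomwise. -/
abbrev Rel {I : Type} (Γ : I → QSet.{u, v}) :=
  ∀ a : (∀ k, (Γ k).At), Submodule ℂ (Functional Γ a)

/-- The inner product of two functionals on the Hilbert space `X₁ ⊗ ⋯ ⊗ Xₙ`, computed in the
orthonormal basis of elementary tensors of basis vectors of the atoms. -/
def functionalInner {I : Type} [Fintype I] [DecidableEq I] {Γ : I → QSet.{u, v}}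
    {a : ∀ k, (Γ k).At} (ξ η : Functional Γ a) : ℂ :=
  ∑ b : (∀ k, Fin (Module.finrank ℂ ((Γ k).atom (a k)))),
    star (ξ fun k => stdOrthonormalBasis ℂ ((Γ k).atom (a k)) (b k)) *
      η fun k => stdOrthonormalBasis ℂ ((Γ k).atom (a k)) (b k)

/-- The orthocomplement of a relation, taken atomwise. -/
def Rel.compl {I : Type} [Fintype I] [DecidableEq I] {Γ : I → QSet.{u, v}} (R : Rel Γ) :
    Rel Γ := fun a =>
  { carrier := {η | ∀ ξ ∈ R a, functionalInner ξ η = 0}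
    zero_mem' := by
      intro ξ _
      simp [functionalInner]
    add_mem' := by
      intro η₁ η₂ h₁ h₂ ξ hξ
      have e : functionalInner ξ (η₁ + η₂) = functionalInner ξ η₁ + functionalInner ξ η₂ := by
        simp [functionalInner, mul_add, Finset.sum_add_distrib]
      rw [e, h₁ ξ hξ, h₂ ξ hξ, add_zero]
    smul_mem' := by
      intro c η h ξ hξ
      have e : functionalInner ξ (c • η) = c * functionalInner ξ η := by
        simp [functionalInner, Finset.mul_sum, mul_left_comm]
      rw [e, h ξ hξ, mul_zero] }

/-- The Cartesian product `P × Q` of relations, with its factors permuted: the arity of `P` is put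
at the positions `s` and that of `Q` at the positions `t`. Here `s` and `t` are injections whose
ranges partition the index type. -/
def Rel.prod {I J K : Type} {Γ : I → QSet.{u, v}} (s : J → I) (t : K → I)
    (P : Rel fun j => Γ (s j)) (Q : Rel fun k => Γ (t k)) : Rel Γ := fun a =>
  Submodule.span ℂ {μ | ∃ ξ ∈ P fun j => a (s j), ∃ η ∈ Q fun k => a (t k),
    ∀ x, μ x = ξ (fun j => x (s j)) * η (fun k => x (t k))}

/-- A relation of arity `(Γ 0, Γ 1)` from spaces of bilinear functionals. -/
def Rel.ofBilin {Γ : Fin 2 → QSet.{u, v}}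
    (B : ∀ (i : (Γ 0).At) (j : (Γ 1).At),
      Submodule ℂ ((Γ 0).atom i →ₗ[ℂ] (Γ 1).atom j →ₗ[ℂ] ℂ)) : Rel Γ := fun a =>
  { carrier := {μ | ∃ β ∈ B (a 0) (a 1), ∀ x, μ x = β (x 0) (x 1)}
    zero_mem' := ⟨0, zero_mem _, by simp⟩
    add_mem' := by
      rintro μ ν ⟨β, hβ, h⟩ ⟨γ, hγ, h'⟩
      exact ⟨β + γ, add_mem hβ hγ, by simp [h, h']⟩
    smul_mem' := by
      rintro c μ ⟨β, hβ, h⟩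
      exact ⟨c • β, Submodule.smul_mem _ c hβ, by simp [h]⟩ }

/-- The evaluation functional `ε : (x, φ) ↦ φ x` on `Y_j ⊗ (Y_j)*`. -/
def evalForm (Y : QSet.{u, v}) (j : Y.dual.At) :
    Y.atom (Y.ofDual j) →ₗ[ℂ] Y.dual.atom j →ₗ[ℂ] ℂ :=
  LinearMap.mk₂ ℂ (fun y (φ : StrongDual ℂ (Y.atom (Y.ofDual j))) => φ y)
    (fun y₁ y₂ φ => map_add (show StrongDual ℂ (Y.atom (Y.ofDual j)) from φ) y₁ y₂)
    (fun c y φ => map_smul (show StrongDual ℂ (Y.atom (Y.ofDual j)) from φ) c y)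
    (fun _ _ _ => rfl) (fun _ _ _ => rfl)

/-- The functional `ε ∘ (r ⊗ 1) : (x, φ) ↦ φ (r x)` on `X_i ⊗ (Y_j)*`, for `r : X_i → Y_j`. -/
def bendForm {X Y : QSet.{u, v}} (i : X.At) (j : Y.dual.At) :
    (X.atom i →L[ℂ] Y.atom (Y.ofDual j)) →ₗ[ℂ] (X.atom i →ₗ[ℂ] Y.dual.atom j →ₗ[ℂ] ℂ) where
  toFun r := evalForm Y j ∘ₗ (r : X.atom i →ₗ[ℂ] Y.atom (Y.ofDual j))
  map_add' _ _ := LinearMap.comp_add _ _ _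
  map_smul' _ _ := LinearMap.comp_smul _ _ _

/-- The binary relation `R` from `X` to `Y`, bent to the relation `E_Y ∘ (R × I_{Y*})` of arity
`(X, Y*)`. -/
def bend {X Y : QSet.{u, v}} (R : BinRel X Y) (i : X.At) (j : Y.dual.At) :
    Submodule ℂ (X.atom i →ₗ[ℂ] Y.dual.atom j →ₗ[ℂ] ℂ) :=
  (R i (Y.ofDual j)).map (bendForm i j)

/-- The equality relation `E_X` of arity `(X, X*)`: spanned by `ε` on `X_i ⊗ (X_i)*`, and zero on
`X_i ⊗ (X_j)*` for `i ≠ j`. -/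
def equality (X : QSet.{u, v}) (i : X.At) (j : X.dual.At) :
    Submodule ℂ (X.atom i →ₗ[ℂ] X.dual.atom j →ₗ[ℂ] ℂ) :=
  Submodule.span ℂ {β | ∃ h : X.ofDual j = i, h ▸ evalForm X j = β}

/-! ### Primitive formulas and their interpretation -/

/-- Primitive formulas in the context `x₁ ∈ Γ 0, …, xₙ ∈ Γ (n - 1)`. An atomic formula applies a
relation to distinct variables; a quantifier binds the first variable of the context. -/
inductive Formula : {n : ℕ} → (Fin n → QSet.{u, v}) → Type (max (u + 1) (v + 1))
  | atomic {n m : ℕ} {Γ : Fin n → QSet.{u, v}} (s : Fin m ↪ Fin n)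
      (R : Rel fun j => Γ (s j)) : Formula Γ
  | neg {n : ℕ} {Γ : Fin n → QSet.{u, v}} (φ : Formula Γ) : Formula Γ
  | and {n : ℕ} {Γ : Fin n → QSet.{u, v}} (φ ψ : Formula Γ) : Formula Γ
  | all {n : ℕ} {Γ : Fin n → QSet.{u, v}} (X : QSet.{u, v})
      (φ : Formula (Fin.cons X Γ : Fin (n + 1) → QSet.{u, v})) : Formula Γ

/-- The relation `⊤_X × R` of arity `(X, X₁, …, Xₙ)`, for `R` of arity `(X₁, …, Xₙ)`. -/
def Rel.topProd {n : ℕ} (X : QSet.{u, v}) {Γ : Fin n → QSet.{u, v}} (R : Rel Γ) :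
    Rel (Fin.cons X Γ : Fin (n + 1) → QSet.{u, v}) :=
  Rel.prod (Γ := (Fin.cons X Γ : Fin (n + 1) → QSet.{u, v}))
    (fun _ : Unit => (0 : Fin (n + 1))) Fin.succ ⊤ R

/-- The interpretation of a primitive formula in its context. -/
def Formula.interp : {n : ℕ} → {Γ : Fin n → QSet.{u, v}} → Formula Γ → Rel Γ
  | _, _, .atomic s R => Rel.prod s (fun k : {k // k ∉ Set.range s} => k.1) R ⊤
  | _, _, .neg φ => φ.interp.compl
  | _, _, .and φ ψ => φ.interp ⊓ ψ.interp
  | _, _, .all X φ => sSup {R | Rel.topProd X R ≤ φ.interp}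

namespace Formula

variable {n : ℕ} {Γ : Fin n → QSet.{u, v}}

/-- `φ ∨ ψ`. -/
def or (φ ψ : Formula Γ) : Formula Γ := (φ.neg.and ψ.neg).neg

/-- The implication `φ → ψ`: the Sasaki arrow `¬φ ∨ (φ ∧ ψ)`. -/
def imp (φ ψ : Formula Γ) : Formula Γ := φ.neg.or (φ.and ψ)

/-- The atomic formula `B(x_p, x_q)` for a relation `B` of arity `(Γ p, Γ q)`. -/
def atomic₂ (p q : Fin n) (hpq : p ≠ q)
    (B : ∀ (i : (Γ p).At) (j : (Γ q).At),
      Submodule ℂ ((Γ p).atom i →ₗ[ℂ] (Γ q).atom j →ₗ[ℂ] ℂ)) : Formula Γ :=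
  .atomic (Γ := Γ) ⟨![p, q], by
      intro a b; fin_cases a <;> fin_cases b <;> simp [hpq, hpq.symm]⟩
    (Rel.ofBilin (Γ := fun k => Γ (![p, q] k)) B)

/-- Quantification over the diagonal: `(∀ (x = x*) ∈ X × X*) φ(x, x*, …)` is
`(∀ x* ∈ X*) (∀ x ∈ X) (E_X(x, x*) → φ(x, x*, …))`. -/
def allDiag (X : QSet.{u, v})
    (φ : Formula (Fin.cons X (Fin.cons X.dual Γ : Fin (n + 1) → QSet.{u, v}) :
      Fin (n + 2) → QSet.{u, v})) : Formula Γ :=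
  .all X.dual (.all X (imp
    (atomic₂ (0 : Fin (n + 2)) (Fin.succ 0) (Fin.succ_ne_zero 0).symm (equality X)) φ))

/-- Truth of a sentence: its interpretation is the relation `⊤` of arity `()`. -/
def IsTrue (φ : Formula (![] : Fin 0 → QSet.{u, v})) : Prop := φ.interp = ⊤

end Formula

/-- The sentence `(∀ (x = x*) ∈ X × X*) R(x, x*)`. The context of the matrix is `(x, x*)`. -/
def reflexivity {X : QSet.{u, v}} (R : BinRel X X) : Formula (![] : Fin 0 → QSet.{u, v}) :=
  .allDiag X (.atomic₂ 0 1 (by decide) (bend R))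

/-- The sentence
`(∀ (x₁ = x₁*) ∈ X × X*) (∀ (x₂ = x₂*) ∈ X × X*) (R(x₁, x₂*) → R(x₂, x₁*))`.
The context of the matrix is `(x₂, x₂*, x₁, x₁*)`. -/
def symmetry {X : QSet.{u, v}} (R : BinRel X X) : Formula (![] : Fin 0 → QSet.{u, v}) :=
  .allDiag X (.allDiag X (.imp
    (.atomic₂ 2 1 (by decide) (bend R)) (.atomic₂ 0 3 (by decide) (bend R))))

/-! ### Quantum graphs in the sense of Weaver -/

section Operators

variable {H : Type*} [NormedAddCommGroup H] [InnerProductSpace ℂ H]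

/-- The ultraweak topology on `L(H)`: the weak topology given by the functionals
`T ↦ ∑ₖ ⟪xₖ, T yₖ⟫` for square-summable sequences `x` and `y` in `H`. -/
@[reducible]
def ultraweak (H : Type*) [NormedAddCommGroup H] [InnerProductSpace ℂ H] :
    TopologicalSpace (H →L[ℂ] H) :=
  ⨅ p : lp (fun _ : ℕ => H) 2 × lp (fun _ : ℕ => H) 2,
    TopologicalSpace.induced (fun T => ∑' k, inner ℂ (p.1 k) (T (p.2 k))) inferInstance

variable [CompleteSpace H]

/-- An operator system: a self-adjoint space of operators that contains the identity. -/
structure IsOperatorSystem (V : Submodule ℂ (H →L[ℂ] H)) : Prop where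
  one_mem : 1 ∈ V
  adjoint_mem : ∀ T ∈ V, ContinuousLinearMap.adjoint T ∈ V

/-- A quantum graph structure on the von Neumann algebra `M ⊆ L(H)`. -/
structure IsQuantumGraph (M : VonNeumannAlgebra H) (V : Submodule ℂ (H →L[ℂ] H)) : Prop where
  isOperatorSystem : IsOperatorSystem V
  isClosed : IsClosed[ultraweak H] (V : Set (H →L[ℂ] H))
  mul_mem_left : ∀ m ∈ M.commutant, ∀ T ∈ V, m * T ∈ V
  mul_mem_right : ∀ m ∈ M.commutant, ∀ T ∈ V, T * m ∈ V

end Operators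

namespace QSet

variable (X : QSet.{u, v})

/-- The `ℓ²`-direct sum of the atoms of `X`. -/
abbrev hilbertSum := lp X.atom 2

open scoped Classical in
/-- The inclusion isometry of an atom into the `ℓ²`-direct sum. -/
def inc (i : X.At) : X.atom i →L[ℂ] X.hilbertSum :=
  lp.singleContinuousLinearMap ℂ X.atom 2 i

open scoped Classical in
theorem inc_adjoint_apply (i : X.At) (v : X.hilbertSum) :
    ContinuousLinearMap.adjoint (X.inc i) v = v i := by
  refine ext_inner_left ℂ fun x => ?_
  rw [ContinuousLinearMap.adjoint_inner_right]
  exact lp.inner_single_left i x v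

open scoped Classical in
theorem norm_inc_apply (i : X.At) (x : X.atom i) : ‖X.inc i x‖ = ‖x‖ :=
  lp.norm_single (by simp) i x

/-- The von Neumann algebra `ℓ∞(X)`, the `ℓ∞`-direct sum of the algebras `L(X_i)`, acting
diagonally on the `ℓ²`-direct sum of the atoms. -/
def ellInfty : VonNeumannAlgebra X.hilbertSum where
  carrier := {T | ∃ a : lp (fun i => X.atom i →L[ℂ] X.atom i) ∞, ∀ v i, (T v) i = a i (v i)}
  mul_mem' := by
    rintro S T ⟨a, ha⟩ ⟨b, hb⟩
    exact ⟨a * b, fun v i => by simp [ha, hb, lp.infty_coeFn_mul]⟩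
  add_mem' := by
    rintro S T ⟨a, ha⟩ ⟨b, hb⟩
    exact ⟨a + b, fun v i => by simp [ha, hb]⟩
  algebraMap_mem' c := by
    refine ⟨c • 1, fun v i => ?_⟩
    simp [Algebra.algebraMap_eq_smul_one, lp.infty_coeFn_one]
  star_mem' := by
    rintro T ⟨a, ha⟩
    refine ⟨star a, fun v i => ?_⟩
    have hT : ∀ x, T (X.inc i x) = X.inc i (a i x) := by
      intro x
      ext j
      rw [ha]
      by_cases hj : j = i
      · subst hj
        simp [inc]
      · simp [inc, hj]
    refine ext_inner_left ℂ fun x => ?_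
    rw [← X.inc_adjoint_apply, ContinuousLinearMap.adjoint_inner_right,
      ContinuousLinearMap.star_eq_adjoint, ContinuousLinearMap.adjoint_inner_right, hT,
      ← ContinuousLinearMap.adjoint_inner_right, X.inc_adjoint_apply,
      ← ContinuousLinearMap.adjoint_inner_right]
    rfl
  centralizer_centralizer' := by
    refine Set.Subset.antisymm (fun T hT => ?_) Set.subset_centralizer_centralizer
    have hcomm : ∀ i v, T (X.inc i (v i)) = X.inc i ((T v) i) := by
      intro i v
      have hp : X.inc i ∘L ContinuousLinearMap.adjoint (X.inc i) ∈ Set.centralizer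
          {T : X.hilbertSum →L[ℂ] X.hilbertSum |
            ∃ a : lp (fun i => X.atom i →L[ℂ] X.atom i) ∞, ∀ v i, (T v) i = a i (v i)} := by
        rintro S ⟨a, ha⟩
        ext w j
        simp only [mul_apply_eq_comp, ContinuousLinearMap.comp_apply,
          X.inc_adjoint_apply, ha]
        by_cases hj : j = i
        · subst hj
          simp [inc]
        · simp [inc, hj]
      have h := congrArg (fun S : X.hilbertSum →L[ℂ] X.hilbertSum => S v) (hT _ hp)
      simp only [mul_apply_eq_comp, ContinuousLinearMap.comp_apply,
        X.inc_adjoint_apply] at h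
      exact h.symm
    have hbound : ∀ i, ‖ContinuousLinearMap.adjoint (X.inc i) ∘L T ∘L X.inc i‖ ≤ ‖T‖ := by
      intro i
      refine ContinuousLinearMap.opNorm_le_bound _ (norm_nonneg _) fun x => ?_
      simp only [ContinuousLinearMap.comp_apply, X.inc_adjoint_apply]
      refine (lp.norm_apply_le_norm (by simp) _ i).trans ((T.le_opNorm _).trans ?_)
      rw [X.norm_inc_apply]
    refine ⟨⟨fun i => ContinuousLinearMap.adjoint (X.inc i) ∘L T ∘L X.inc i,
      memℓp_infty ⟨‖T‖, ?_⟩⟩, fun v i => ?_⟩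
    · rintro _ ⟨i, rfl⟩
      exact hbound i
    · change (T v) i = ContinuousLinearMap.adjoint (X.inc i) (T (X.inc i (v i)))
      rw [hcomm, X.inc_adjoint_apply]
      simp [inc]

/-- The binary relation `R(X_i, X_j) = inc_j† · V · inc_i` on `X` given by a space `V` of
operators. -/
def toBinRel (V : Submodule ℂ (X.hilbertSum →L[ℂ] X.hilbertSum)) : BinRel X X := fun i j =>
  { carrier := {r | ∃ T ∈ V, ContinuousLinearMap.adjoint (X.inc j) ∘L T ∘L X.inc i = r}
    zero_mem' := ⟨0, zero_mem _, by simp⟩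
    add_mem' := by
      rintro _ _ ⟨S, hS, rfl⟩ ⟨T, hT, rfl⟩
      exact ⟨S + T, add_mem hS hT, by simp⟩
    smul_mem' := by
      rintro c _ ⟨T, hT, rfl⟩
      exact ⟨c • T, Submodule.smul_mem _ c hT, by simp⟩ }

end QSet

end QuantumLogic

end

noncomputable section

namespace QuantumLogic

/-! ### The inner product of functionals -/

section Functional

variable {I : Type} [Fintype I] [DecidableEq I] {Γ : I → QSet.{u, v}} {a : ∀ k, (Γ k).At}

/-! The two sentences are first translated into statements about operators: (1) says that every `R i
i` contains the identity (`reflexivity_isTrue_iff`), and (2) says that taking adjoints maps `R i j`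
into `R j i` (`symmetry_isTrue_iff`).

For the translation, a vector lies in the Sasaki arrow `P → Q` exactly when its orthogonal
projection to `P` lies in `Q` (`mem_sasaki_iff`). If `P` is the equality relation, projections to
`P` are multiples of the evaluation `ε` on matching atoms and vanish on the others. Quantifying over
the diagonal therefore amounts to inserting `ε` for each atom (`Formula.mem_interp_allDiag_iff`).
Since `ε` is the identity operator bent into a functional, (1) follows at once.

For (2), the functional to test is `ε ⊗ ε` in the variables `(x₂, x₂*, x₁, x₁*)`. Regrouped along
`(x₁, x₂*)` and `(x₂, x₁*)`, it represents a conjugate-linear map between spaces of functionals. Its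
projection to `P × ⊤` represents that map composed with the projection to `P`, and lies in `⊤ × Q`
iff the map sends `P` into `Q` (`exists_projection_of_conjLinear`). Under bending, the map is `r ↦
r†` (`bendForm_adjoint`).

On the operator side, the commutant of `ℓ∞(X)` acts on each atom by a scalar and contains the
projections to the atoms. Hence the operators with all corners in `R` form a bimodule over the
commutant, ultraweakly closed because each corner is finite-dimensional. Conversely, a quantum graph
`V` contains every operator whose corners are corners of members of `V`: compressions to finitely
many atoms lie in `V` and converge ultraweakly (`QSet.ofBinRel_toBinRel`). With a single atom, a
relation is just one subspace of `L(H)`. -/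

theorem Functional.eval_eq_sum (ω : Functional Γ a) (y : ∀ k, (Γ k).atom (a k)) :
    ω y = ∑ c : (∀ k, Fin (Module.finrank ℂ ((Γ k).atom (a k)))),
      (∏ k, inner ℂ (stdOrthonormalBasis ℂ ((Γ k).atom (a k)) (c k)) (y k)) *
        ω fun k => stdOrthonormalBasis ℂ ((Γ k).atom (a k)) (c k) := by
  have h : y = fun k => ∑ j, inner ℂ (stdOrthonormalBasis ℂ ((Γ k).atom (a k)) j) (y k) •
      stdOrthonormalBasis ℂ ((Γ k).atom (a k)) j :=
    funext fun k => ((stdOrthonormalBasis ℂ ((Γ k).atom (a k))).sum_repr' (y k)).symm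
  conv_lhs => rw [h]
  rw [MultilinearMap.map_sum]
  refine Finset.sum_congr rfl fun c _ => ?_
  rw [MultilinearMap.map_smul_univ, smul_eq_mul]

/-- The inner product of functionals is positive definite. -/
abbrev functionalCore (Γ : I → QSet.{u, v}) (a : ∀ k, (Γ k).At) :
    InnerProductSpace.Core ℂ (Functional Γ a) where
  inner := functionalInner
  conj_inner_symm ξ η := by
    simp [functionalInner, mul_comm]
  re_inner_nonneg ξ := by
    simp only [functionalInner, map_sum]
    refine Finset.sum_nonneg fun b _ => ?_
    rw [RCLike.star_def, RCLike.conj_mul]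
    norm_cast
    positivity
  add_left ξ η ζ := by
    simp [functionalInner, add_mul, Finset.sum_add_distrib]
  smul_left ξ η c := by
    simp [functionalInner, Finset.mul_sum, mul_assoc]
  definite ξ h := by
    have h' : ∀ b : (∀ k, Fin (Module.finrank ℂ ((Γ k).atom (a k)))),
        ξ (fun k => stdOrthonormalBasis ℂ ((Γ k).atom (a k)) (b k)) = 0 := by
      have h0 : ((∑ b : (∀ k, Fin (Module.finrank ℂ ((Γ k).atom (a k)))),
          ‖ξ fun k => stdOrthonormalBasis ℂ ((Γ k).atom (a k)) (b k)‖ ^ 2 : ℝ) : ℂ) = 0 := by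
        rw [← h]
        simp only [functionalInner, RCLike.star_def, RCLike.conj_mul]
        push_cast
        rfl
      rw [Complex.ofReal_eq_zero, Finset.sum_eq_zero_iff_of_nonneg fun _ _ => by positivity] at h0
      intro b
      simpa using h0 b (Finset.mem_univ b)
    ext y
    rw [ξ.eval_eq_sum]
    simp [h']

instance : NormedAddCommGroup (Functional Γ a) :=
  @InnerProductSpace.Core.toNormedAddCommGroup ℂ _ _ _ _ (functionalCore Γ a)

instance : InnerProductSpace ℂ (Functional Γ a) :=
  InnerProductSpace.ofCore (functionalCore Γ a).toCore

theorem inner_functional (ξ η : Functional Γ a) : inner ℂ ξ η = functionalInner ξ η := rfl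

theorem Rel.compl_apply (R : Rel Γ) : R.compl a = (R a)ᗮ := by
  ext η
  exact (Submodule.mem_orthogonal _ _).symm

end Functional

/-! ### The Sasaki arrow in terms of orthogonal projections -/

/-- Here `p` is the orthogonal projection of `v` to `P`, and the subspace on the left is `Pᗮ ∨ (P ⊓
Q)`, the arrow from `P` to `Q`. -/
theorem mem_sasaki_iff {E : Type*} [NormedAddCommGroup E] [InnerProductSpace ℂ E]
    [FiniteDimensional ℂ E] (P Q : Submodule ℂ E) {v p : E} (hp : p ∈ P) (hvp : v - p ∈ Pᗮ) :
    v ∈ (Pᗮᗮ ⊓ (P ⊓ Q)ᗮ)ᗮ ↔ p ∈ Q := by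
  rw [Submodule.orthogonal_orthogonal]
  constructor
  · intro hv
    -- The part `r` of `p` orthogonal to `P ⊓ Q` still lies in `P`. It is therefore orthogonal to
    -- both `v` and `v - p`, hence to `p = q + r`, and so vanishes.
    obtain ⟨q, hq, r, hr, h⟩ := (P ⊓ Q).exists_add_mem_mem_orthogonal p
    have hrP : r ∈ P := by
      have : r = p - q := by rw [h]; abel
      exact this ▸ sub_mem hp hq.1
    have h1 : inner ℂ r v = 0 := hv r ⟨hrP, hr⟩
    have h2 : inner ℂ r (v - p) = 0 := hvp r hrP
    have h3 : inner ℂ r q = 0 := (Submodule.mem_orthogonal' _ _).1 hr q hq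
    have h4 : inner ℂ r r = (0 : ℂ) := by
      rw [inner_sub_right, h1, h, inner_add_right, h3] at h2
      simpa using h2
    rw [inner_self_eq_zero] at h4
    rw [h, h4, add_zero]
    exact hq.2
  · rintro hpQ w ⟨hwP, hw⟩
    rw [← sub_add_cancel v p, inner_add_right, hvp w hwP,
      (Submodule.mem_orthogonal' _ _).1 hw p ⟨hp, hpQ⟩, add_zero]

theorem Formula.mem_interp_imp_iff {n : ℕ} {Γ : Fin n → QSet.{u, v}} (φ ψ : Formula Γ)
    {a : ∀ k, (Γ k).At} {v p : Functional Γ a} (hp : p ∈ φ.interp a)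
    (hvp : v - p ∈ (φ.interp a)ᗮ) : v ∈ (φ.imp ψ).interp a ↔ p ∈ ψ.interp a := by
  rw [← mem_sasaki_iff (φ.interp a) (ψ.interp a) hp hvp]
  simp only [Formula.imp, Formula.or, Formula.interp, Rel.compl_apply, Pi.inf_apply]

/-! ### Products of functionals -/

section Product

variable {I J K : Type} {Γ : I → QSet.{u, v}} {s : J → I} {t : K → I}

theorem bijective_restrict (hst : Function.Bijective (Sum.elim s t)) (β : I → Type*) :
    Function.Bijective fun b : (∀ k, β k) =>
      ((fun j => b (s j), fun k => b (t k)) : (∀ j, β (s j)) × (∀ k, β (t k))) := by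
  constructor
  · intro b c h
    obtain ⟨h₁, h₂⟩ := Prod.ext_iff.1 h
    funext k
    obtain ⟨j | j, rfl⟩ := hst.2 k
    · exact congrFun h₁ j
    · exact congrFun h₂ j
  · rintro ⟨c, d⟩
    let e := Equiv.ofBijective _ hst
    let w : ∀ p : J ⊕ K, β (e p) := fun p => match p with
      | .inl j => c j
      | .inr k => d k
    have hw (p : J ⊕ K) : e.piCongrLeft β w (e p) = w p := e.piCongrLeft_apply_apply β w p
    exact ⟨e.piCongrLeft β w, Prod.ext (funext fun j => hw (.inl j)) (funext fun k => hw (.inr k))⟩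

theorem restrict_update_of_ne [DecidableEq I] {β : I → Type*} {l : I}
    (h : ∀ j, s j ≠ l) (x : ∀ k, β k) (y : β l) :
    (fun j => Function.update x l y (s j)) = fun j => x (s j) :=
  funext fun j => Function.update_of_ne (h j) y x

theorem restrict_update [DecidableEq I] [DecidableEq J] {β : I → Type*} (hs : Function.Injective s)
    (j : J) (x : ∀ k, β k) (y : β (s j)) :
    (fun i => Function.update x (s j) y (s i)) = Function.update (fun i => x (s i)) j y :=
  Function.update_comp_eq_of_injective' x hs j y

theorem range_cases (hst : Function.Bijective (Sum.elim s t)) (l : I) :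
    (∃ j, s j = l) ∨ ∃ k, t k = l := by
  obtain ⟨j | k, h⟩ := hst.2 l
  exacts [.inl ⟨j, h⟩, .inr ⟨k, h⟩]

theorem bijective_sumElim_swap (hst : Function.Bijective (Sum.elim s t)) :
    Function.Bijective (Sum.elim t s) := by
  have h : Sum.elim t s = Sum.elim s t ∘ Equiv.sumComm K J := by
    ext (_ | _) <;> rfl
  rw [h]
  exact hst.comp (Equiv.bijective _)

/-- The product functional `x ↦ ξ (x ∘ s) * η (x ∘ t)`, for `s` and `t` complementary. -/
def tmul (hst : Function.Bijective (Sum.elim s t)) {a : ∀ k, (Γ k).At}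
    (ξ : Functional (fun j => Γ (s j)) fun j => a (s j))
    (η : Functional (fun k => Γ (t k)) fun k => a (t k)) : Functional Γ a where
  toFun x := ξ (fun j => x (s j)) * η (fun k => x (t k))
  map_update_add' := by
    classical
    intro _ x l y z
    have hs : Function.Injective s := fun i j h => Sum.inl_injective (hst.1 h)
    have ht : Function.Injective t := fun i j h => Sum.inr_injective (hst.1 h)
    obtain ⟨j, rfl⟩ | ⟨j, rfl⟩ := range_cases hst l
    · have hne : ∀ k, t k ≠ s j := fun k h => Sum.inr_ne_inl (hst.1 h)
      simp only [restrict_update hs, restrict_update_of_ne hne]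
      rw [ξ.map_update_add, add_mul]
    · have hne : ∀ k, s k ≠ t j := fun k h => Sum.inl_ne_inr (hst.1 h)
      simp only [restrict_update ht, restrict_update_of_ne hne]
      rw [η.map_update_add, mul_add]
  map_update_smul' := by
    classical
    intro _ x l c y
    have hs : Function.Injective s := fun i j h => Sum.inl_injective (hst.1 h)
    have ht : Function.Injective t := fun i j h => Sum.inr_injective (hst.1 h)
    obtain ⟨j, rfl⟩ | ⟨j, rfl⟩ := range_cases hst l
    · have hne : ∀ k, t k ≠ s j := fun k h => Sum.inr_ne_inl (hst.1 h)
      simp only [restrict_update hs, restrict_update_of_ne hne]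
      rw [ξ.map_update_smul, smul_mul_assoc]
    · have hne : ∀ k, s k ≠ t j := fun k h => Sum.inl_ne_inr (hst.1 h)
      simp only [restrict_update ht, restrict_update_of_ne hne]
      rw [η.map_update_smul, mul_smul_comm]

variable (hst : Function.Bijective (Sum.elim s t)) {a : ∀ k, (Γ k).At}

theorem tmul_apply (ξ : Functional (fun j => Γ (s j)) fun j => a (s j))
    (η : Functional (fun k => Γ (t k)) fun k => a (t k)) (x : ∀ k, (Γ k).atom (a k)) :
    tmul hst ξ η x = ξ (fun j => x (s j)) * η (fun k => x (t k)) := rfl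

theorem tmul_mem_prod {P : Rel fun j => Γ (s j)} {Q : Rel fun k => Γ (t k)}
    {ξ : Functional (fun j => Γ (s j)) fun j => a (s j)}
    {η : Functional (fun k => Γ (t k)) fun k => a (t k)} (hξ : ξ ∈ P _) (hη : η ∈ Q _) :
    tmul hst ξ η ∈ Rel.prod s t P Q a :=
  Submodule.subset_span ⟨ξ, hξ, η, hη, fun _ => rfl⟩

theorem prod_le {P : Rel fun j => Γ (s j)} {Q : Rel fun k => Γ (t k)}
    {S : Submodule ℂ (Functional Γ a)}
    (h : ∀ ξ ∈ P fun j => a (s j), ∀ η ∈ Q fun k => a (t k), tmul hst ξ η ∈ S) :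
    Rel.prod s t P Q a ≤ S := by
  refine Submodule.span_le.2 ?_
  rintro μ ⟨ξ, hξ, η, hη, hμ⟩
  have : μ = tmul hst ξ η := MultilinearMap.ext hμ
  exact this ▸ h ξ hξ η hη

theorem prod_swap (P : Rel fun j => Γ (s j)) (Q : Rel fun k => Γ (t k)) :
    Rel.prod s t P Q = Rel.prod t s Q P := by
  funext a
  simp only [Rel.prod]
  congr 1
  ext μ
  constructor
  · rintro ⟨ξ, hξ, η, hη, h⟩
    exact ⟨η, hη, ξ, hξ, fun x => (h x).trans (mul_comm _ _)⟩
  · rintro ⟨ξ, hξ, η, hη, h⟩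
    exact ⟨η, hη, ξ, hξ, fun x => (h x).trans (mul_comm _ _)⟩

theorem sum_restrict [Fintype I] [Fintype J] [Fintype K] [DecidableEq I] [DecidableEq J]
    [DecidableEq K] (hst : Function.Bijective (Sum.elim s t)) {β : I → Type*}
    [∀ k, Fintype (β k)] (f : (∀ j, β (s j)) → (∀ k, β (t k)) → ℂ) :
    ∑ b : (∀ k, β k), f (fun j => b (s j)) (fun k => b (t k)) = ∑ c, ∑ d, f c d := by
  rw [← Fintype.sum_prod_type']
  exact Fintype.sum_bijective _ (bijective_restrict hst β) _ _ fun _ => rfl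

/-- The basis of elementary tensors indexed by all variables is the product of those indexed by `s`
and by `t`, so the sum factors. -/
theorem inner_tmul_tmul [Fintype I] [Fintype J] [Fintype K] [DecidableEq I] [DecidableEq J]
    [DecidableEq K] (ξ ξ' : Functional (fun j => Γ (s j)) fun j => a (s j))
    (η η' : Functional (fun k => Γ (t k)) fun k => a (t k)) :
    inner ℂ (tmul hst ξ η) (tmul hst ξ' η') = inner ℂ ξ ξ' * inner ℂ η η' := by
  simp only [inner_functional, functionalInner, tmul_apply]
  rw [Fintype.sum_mul_sum]
  refine Eq.trans ?_ (sum_restrict hst (β := fun k => Fin (Module.finrank ℂ ((Γ k).atom (a k)))) _)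
  refine Finset.sum_congr rfl fun b _ => ?_
  rw [star_mul']
  ring

section Orthogonal

variable [Fintype I] [Fintype J] [Fintype K] [DecidableEq I] [DecidableEq J] [DecidableEq K]

theorem tmul_mem_prod_orthogonal_left {P : Rel fun j => Γ (s j)} (Q : Rel fun k => Γ (t k))
    {ξ : Functional (fun j => Γ (s j)) fun j => a (s j)} (hξ : ξ ∈ (P _)ᗮ)
    (η : Functional (fun k => Γ (t k)) fun k => a (t k)) :
    tmul hst ξ η ∈ (Rel.prod s t P Q a)ᗮ := by
  have h : Rel.prod s t P Q a ≤ (ℂ ∙ tmul hst ξ η)ᗮ := by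
    refine prod_le hst fun ξ' hξ' η' _ => ?_
    rw [Submodule.mem_orthogonal_singleton_iff_inner_left, inner_tmul_tmul, hξ ξ' hξ', zero_mul]
  intro μ hμ
  exact Submodule.mem_orthogonal_singleton_iff_inner_left.1 (h hμ)

theorem tmul_mem_prod_orthogonal_right (P : Rel fun j => Γ (s j)) {Q : Rel fun k => Γ (t k)}
    (ξ : Functional (fun j => Γ (s j)) fun j => a (s j))
    {η : Functional (fun k => Γ (t k)) fun k => a (t k)} (hη : η ∈ (Q _)ᗮ) :
    tmul hst ξ η ∈ (Rel.prod s t P Q a)ᗮ := by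
  have h : Rel.prod s t P Q a ≤ (ℂ ∙ tmul hst ξ η)ᗮ := by
    refine prod_le hst fun ξ' _ η' hη' => ?_
    rw [Submodule.mem_orthogonal_singleton_iff_inner_left, inner_tmul_tmul, hη η' hη', mul_zero]
  intro μ hμ
  exact Submodule.mem_orthogonal_singleton_iff_inner_left.1 (h hμ)

theorem tmul_mem_prod_top_iff {P : Rel fun j => Γ (s j)}
    (ξ : Functional (fun j => Γ (s j)) fun j => a (s j))
    {η : Functional (fun k => Γ (t k)) fun k => a (t k)} (hη : η ≠ 0) :
    tmul hst ξ η ∈ Rel.prod s t P ⊤ a ↔ ξ ∈ P _ := by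
  refine ⟨fun h => ?_, fun h => tmul_mem_prod hst h trivial⟩
  -- Testing against `ζ ⊗ η` with `ζ ∈ Pᗮ` gives `⟪ζ, ξ⟫ * ⟪η, η⟫ = 0`, and the second factor is
  -- nonzero.
  rw [← Submodule.orthogonal_orthogonal (P _)]
  intro ζ hζ
  have h0 := (Submodule.mem_orthogonal' _ _).1 (tmul_mem_prod_orthogonal_left hst ⊤ hζ η) _ h
  rw [inner_tmul_tmul] at h0
  exact (mul_eq_zero.1 h0).resolve_right (by simpa using hη)

/-- Let `v` be the functional that represents the conjugate-linear map `A`. Its orthogonal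
projection to `P × ⊤` belongs to `⊤ × Q` if and only if `A` maps `P` to `Q`. -/
theorem exists_projection_of_conjLinear (P : Rel fun j => Γ (s j)) (Q : Rel fun k => Γ (t k))
    (A : Functional (fun j => Γ (s j)) (fun j => a (s j)) →ₗ⋆[ℂ]
      Functional (fun k => Γ (t k)) fun k => a (t k)) (v : Functional Γ a)
    (hv : ∀ ξ η, inner ℂ (tmul hst ξ η) v = inner ℂ η (A ξ)) :
    ∃ p ∈ Rel.prod s t P ⊤ a, v - p ∈ (Rel.prod s t P ⊤ a)ᗮ ∧
      (p ∈ Rel.prod s t ⊤ Q a ↔ ∀ ξ ∈ P fun j => a (s j), A ξ ∈ Q fun k => a (t k)) := by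
  -- The functional `p = ∑ uₖ ⊗ A uₖ` represents `A` composed with the projection to `P`: on `ξ ∈ P`
  -- it yields `A ξ` because `A` is conjugate-linear.
  let u := stdOrthonormalBasis ℂ (P fun j => a (s j))
  let p := ∑ k, tmul hst (u k : Functional (fun j => Γ (s j)) fun j => a (s j)) (A (u k))
  have hp : p ∈ Rel.prod s t P ⊤ a := sum_mem fun k _ => tmul_mem_prod hst (u k).2 trivial
  have hinner : ∀ ξ ∈ P fun j => a (s j), ∀ η, inner ℂ (tmul hst ξ η) p = inner ℂ η (A ξ) := by
    intro ξ hξ η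
    have e : ξ = ∑ k, inner ℂ (u k : Functional (fun j => Γ (s j)) fun j => a (s j)) ξ •
        (u k : Functional (fun j => Γ (s j)) fun j => a (s j)) := by
      have := congrArg Subtype.val (u.sum_repr' ⟨ξ, hξ⟩).symm
      simpa using this
    conv_rhs => rw [e]
    simp only [p, inner_sum, inner_tmul_tmul, map_sum, map_smulₛₗ, inner_smul_right,
      inner_conj_symm]
  have hvp : v - p ∈ (Rel.prod s t P ⊤ a)ᗮ := by
    have h : Rel.prod s t P ⊤ a ≤ (ℂ ∙ (v - p))ᗮ := by
      refine prod_le hst fun ξ hξ η _ => ?_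
      rw [Submodule.mem_orthogonal_singleton_iff_inner_left, inner_sub_right, hv, hinner ξ hξ,
        sub_self]
    intro μ hμ
    exact Submodule.mem_orthogonal_singleton_iff_inner_left.1 (h hμ)
  refine ⟨p, hp, hvp, fun h ξ hξ => ?_, fun h => sum_mem fun k _ =>
    tmul_mem_prod hst trivial (h _ (u k).2)⟩
  rw [← Submodule.orthogonal_orthogonal (Q _)]
  intro η hη
  rw [← hinner ξ hξ]
  exact (Submodule.mem_orthogonal' _ _).1 (tmul_mem_prod_orthogonal_right hst ⊤ ξ hη) _ h

end Orthogonal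

/-- `P × ⊤` does not depend on the enumeration of the variables that do not occur in `P`. -/
theorem prod_top_congr {K' : Type} {t' : K' → I} (hst : Function.Bijective (Sum.elim s t))
    (hst' : Function.Bijective (Sum.elim s t')) (P : Rel fun j => Γ (s j)) :
    Rel.prod s t P ⊤ = Rel.prod s t' P ⊤ := by
  suffices H : ∀ {K K' : Type} {t : K → I} {t' : K' → I}, Function.Bijective (Sum.elim s t) →
      Function.Bijective (Sum.elim s t') → Rel.prod s t P ⊤ ≤ Rel.prod s t' P ⊤ from
    le_antisymm (H hst hst') (H hst' hst)
  clear hst hst'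
  intro K K' t t' hst hst' a
  have hmem : ∀ {K K' : Type} {t : K → I} {t' : K' → I}, Function.Bijective (Sum.elim s t) →
      Function.Bijective (Sum.elim s t') → ∀ k, ∃ k', t' k' = t k := by
    intro K K' t t' hst hst' k
    refine (range_cases hst' (t k)).resolve_left ?_
    rintro ⟨j, hj⟩
    exact Sum.inl_ne_inr (hst.1 (show Sum.elim s t (.inl j) = Sum.elim s t (.inr k) from hj))
  -- Both enumerations are injective with range the complement of the range of `s`, so they differ
  -- by a bijection.
  obtain ⟨e, rfl⟩ : ∃ e : K ≃ K', t = fun k => t' (e k) := by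
    have ht : Function.Injective t := fun i j h => Sum.inr_injective (hst.1 h)
    have ht' : Function.Injective t' := fun i j h => Sum.inr_injective (hst'.1 h)
    choose f hf using hmem hst hst'
    choose g hg using hmem hst' hst
    exact ⟨⟨f, g, fun k => ht (by rw [hg, hf]), fun k => ht' (by rw [hf, hg])⟩,
      funext fun k => (hf k).symm⟩
  refine prod_le hst fun ξ hξ η _ => Submodule.subset_span ⟨ξ, hξ,
    (MultilinearMap.domDomCongrLinearEquiv' ℂ ℂ (fun k => (Γ (t' k)).atom (a (t' k))) ℂ
      e.symm).symm η, trivial, fun x => ?_⟩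
  rfl

end Product

/-! ### Bilinear functionals -/

section Bilinear

variable {Γ : Fin 2 → QSet.{u, v}} {a : ∀ k, (Γ k).At}

/-- The functional on a tensor product of two atoms that is given by a bilinear map. -/
def bilinFunctional (β : (Γ 0).atom (a 0) →ₗ[ℂ] (Γ 1).atom (a 1) →ₗ[ℂ] ℂ) : Functional Γ a where
  toFun x := β (x 0) (x 1)
  map_update_add' := by
    intro _ x l y z
    obtain rfl | rfl : l = 0 ∨ l = 1 := by omega
    · simp
    · simp
  map_update_smul' := by
    intro _ x l c y
    obtain rfl | rfl : l = 0 ∨ l = 1 := by omega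
    · simp
    · simp

theorem bilinFunctional_injective :
    Function.Injective (bilinFunctional (Γ := Γ) (a := a)) := by
  intro β γ h
  ext y z
  exact congrArg (fun μ : Functional Γ a => μ (Fin.cons (α := fun k => (Γ k).atom (a k)) y
    (Fin.cons (α := fun k : Fin 1 => (Γ k.succ).atom (a k.succ)) z finZeroElim))) h

theorem mem_ofBilin_iff (B : ∀ (i : (Γ 0).At) (j : (Γ 1).At),
      Submodule ℂ ((Γ 0).atom i →ₗ[ℂ] (Γ 1).atom j →ₗ[ℂ] ℂ)) (μ : Functional Γ a) :
    μ ∈ Rel.ofBilin B a ↔ ∃ β ∈ B (a 0) (a 1), bilinFunctional β = μ := by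
  refine exists_congr fun β => and_congr_right fun _ => ?_
  exact ⟨fun h => MultilinearMap.ext fun x => (h x).symm, fun h x => h ▸ rfl⟩

theorem bilinFunctional_mem_ofBilin_iff {B : ∀ (i : (Γ 0).At) (j : (Γ 1).At),
      Submodule ℂ ((Γ 0).atom i →ₗ[ℂ] (Γ 1).atom j →ₗ[ℂ] ℂ)}
    {β : (Γ 0).atom (a 0) →ₗ[ℂ] (Γ 1).atom (a 1) →ₗ[ℂ] ℂ} :
    bilinFunctional β ∈ Rel.ofBilin B a ↔ β ∈ B (a 0) (a 1) := by
  rw [mem_ofBilin_iff]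
  constructor
  · rintro ⟨γ, hγ, h⟩
    exact bilinFunctional_injective h ▸ hγ
  · exact fun h => ⟨β, h, rfl⟩

theorem bijective_sumElim_zero_one :
    Function.Bijective (Sum.elim (fun _ : Unit => (0 : Fin 2)) fun _ : Unit => (1 : Fin 2)) := by
  decide

/-- Elementary products span all functionals, so a functional orthogonal to all of them is
orthogonal to itself. This keeps the projections to `ℂ ∙ ε` from all vanishing. -/
theorem exists_inner_tmul_ne_zero {ω : Functional Γ a} (hω : ω ≠ 0) :
    ∃ ξ η, inner ℂ ω (tmul bijective_sumElim_zero_one ξ η) ≠ 0 := by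
  by_contra! h
  apply hω
  rw [← inner_self_eq_zero (𝕜 := ℂ)]
  let f (k : Fin 2) (j : Fin (Module.finrank ℂ ((Γ k).atom (a k)))) :
      Functional (fun _ : Unit => Γ k) fun _ => a k :=
    MultilinearMap.ofSubsingleton ℂ _ _ ()
      (innerₛₗ ℂ (stdOrthonormalBasis ℂ ((Γ k).atom (a k)) j))
  have e : ω = ∑ c : (∀ k, Fin (Module.finrank ℂ ((Γ k).atom (a k)))),
      (ω fun k => stdOrthonormalBasis ℂ ((Γ k).atom (a k)) (c k)) •
        tmul bijective_sumElim_zero_one (f 0 (c 0)) (f 1 (c 1)) := by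
    ext x
    rw [ω.eval_eq_sum, sum_apply]
    refine Finset.sum_congr rfl fun c _ => ?_
    rw [Fin.prod_univ_two, mul_comm]
    rfl
  conv_lhs => arg 3; rw [e]
  rw [inner_sum]
  refine Finset.sum_eq_zero fun c _ => ?_
  rw [inner_smul_right, h, mul_zero]

end Bilinear

/-! ### Interpretation of quantifiers -/

section Tmul

variable {I J K : Type} {Γ : I → QSet.{u, v}} {s : J → I} {t : K → I}
  (hst : Function.Bijective (Sum.elim s t)) {a : ∀ k, (Γ k).At}

/-- Multiplication by a functional on the left, as a linear map. -/
def tmulRight (ξ : Functional (fun j => Γ (s j)) fun j => a (s j)) :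
    (Functional (fun k => Γ (t k)) fun k => a (t k)) →ₗ[ℂ] Functional Γ a where
  toFun η := tmul hst ξ η
  map_add' η η' := by
    ext x
    simp [tmul_apply, mul_add]
  map_smul' c η := by
    ext x
    simp [tmul_apply, mul_left_comm]

theorem tmul_smul_left (c : ℂ) (ξ : Functional (fun j => Γ (s j)) fun j => a (s j))
    (η : Functional (fun k => Γ (t k)) fun k => a (t k)) :
    tmul hst (c • ξ) η = c • tmul hst ξ η := by
  ext x
  simp [tmul_apply, mul_assoc]

theorem tmul_sub_left (ξ ξ' : Functional (fun j => Γ (s j)) fun j => a (s j))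
    (η : Functional (fun k => Γ (t k)) fun k => a (t k)) :
    tmul hst (ξ - ξ') η = tmul hst ξ η - tmul hst ξ' η := by
  ext x
  simp [tmul_apply, sub_mul]

end Tmul

theorem bijective_sumElim_zero_succ (n : ℕ) :
    Function.Bijective (Sum.elim (fun _ : Unit => (0 : Fin (n + 1))) Fin.succ) := by
  constructor
  · rintro (⟨⟩ | i) (⟨⟩ | j) h
    · rfl
    · exact absurd h (Fin.succ_ne_zero j).symm
    · exact absurd h (Fin.succ_ne_zero i)
    · exact congrArg _ (Fin.succ_injective _ h)
  · intro k
    refine Fin.cases ⟨.inl (), rfl⟩ (fun i => ⟨.inr i, rfl⟩) k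

theorem bijective_sumElim_succ_succ (n : ℕ) :
    Function.Bijective (Sum.elim ![(0 : Fin (n + 2)), Fin.succ 0]
      fun k : Fin n => k.succ.succ) := by
  constructor
  · rintro (i | i) (j | j) h
    · fin_cases i <;> fin_cases j <;> simp_all
    · fin_cases i <;> simp [Fin.ext_iff] at h
    · fin_cases j <;> simp [Fin.ext_iff] at h
    · simpa using h
  · intro k
    refine Fin.cases ⟨.inl 0, rfl⟩ (fun i => ?_) k
    exact Fin.cases ⟨.inl 1, rfl⟩ (fun i => ⟨.inr i, rfl⟩) i

theorem bijective_sumElim_compl {m n : ℕ} (s : Fin m ↪ Fin n) :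
    Function.Bijective (Sum.elim s fun k : {k // k ∉ Set.range s} => k.1) := by
  constructor
  · rintro (i | ⟨i, hi⟩) (j | ⟨j, hj⟩) h
    · exact congrArg _ (s.injective h)
    · exact absurd ⟨i, h⟩ hj
    · exact absurd ⟨j, h.symm⟩ hi
    · exact congrArg _ (Subtype.ext h)
  · intro k
    by_cases hk : k ∈ Set.range s
    · obtain ⟨j, rfl⟩ := hk
      exact ⟨.inl j, rfl⟩
    · exact ⟨.inr ⟨k, hk⟩, rfl⟩

section Quantifier

variable {n : ℕ} {Γ : Fin n → QSet.{u, v}}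

/-- A choice of atoms for an extended context. -/
abbrev consAt {X : QSet.{u, v}} (i : X.At) (a : ∀ k, (Γ k).At) :
    ∀ k, ((Fin.cons X Γ : Fin (n + 1) → QSet.{u, v}) k).At :=
  Fin.cons (α := fun k => ((Fin.cons X Γ : Fin (n + 1) → QSet.{u, v}) k).At) i a

/-- The product of a functional on an atom with a functional in the given context. -/
abbrev consMul {X : QSet.{u, v}} {i : X.At} {a : ∀ k, (Γ k).At}
    (ξ : Functional (fun _ : Unit => X) fun _ => i) (η : Functional Γ a) :
    Functional (Fin.cons X Γ : Fin (n + 1) → QSet.{u, v}) (consAt i a) :=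
  tmul (Γ := (Fin.cons X Γ : Fin (n + 1) → QSet.{u, v})) (a := consAt i a)
    (bijective_sumElim_zero_succ n) ξ η

namespace Formula

/-- The supremum defining the quantifier is attained: the condition on the right defines a subspace
for each choice of atoms, and these form the largest admissible relation. -/
theorem mem_interp_all_iff (X : QSet.{u, v})
    (φ : Formula (Fin.cons X Γ : Fin (n + 1) → QSet.{u, v})) {a : ∀ k, (Γ k).At}
    (η : Functional Γ a) : η ∈ (Formula.all X φ).interp a ↔
      ∀ (i : X.At) (ξ : Functional (fun _ : Unit => X) fun _ => i),
        consMul ξ η ∈ φ.interp (consAt i a) := by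
  let Q : Rel Γ := fun a => ⨅ (i : X.At), ⨅ (ξ : Functional (fun _ : Unit => X) fun _ => i),
    (φ.interp (consAt i a)).comap (tmulRight (Γ := (Fin.cons X Γ : Fin (n + 1) → QSet.{u, v}))
      (a := consAt i a) (bijective_sumElim_zero_succ n) ξ)
  have hQ (a) (η : Functional Γ a) : η ∈ Q a ↔ ∀ (i : X.At)
      (ξ : Functional (fun _ : Unit => X) fun _ => i), consMul ξ η ∈ φ.interp (consAt i a) := by
    simp only [Q, Submodule.mem_iInf]
    rfl
  rw [← hQ]
  suffices h : (Formula.all X φ).interp = Q by rw [h]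
  simp only [Formula.interp]
  refine le_antisymm (sSup_le fun R hR a η hη => ?_) (le_sSup fun a => ?_)
  · rw [hQ]
    exact fun i ξ => hR (consAt i a) (tmul_mem_prod
      (Γ := (Fin.cons X Γ : Fin (n + 1) → QSet.{u, v})) (a := consAt i a)
      (bijective_sumElim_zero_succ n) trivial hη)
  -- Every choice of atoms for the extended context splits into an atom of `X` and a choice for `Γ`.
  · obtain ⟨i, a, rfl⟩ : ∃ i a', a = consAt i a' := ⟨a 0, fun k => a k.succ,
      (Fin.cons_self_tail a).symm⟩
    refine prod_le (Γ := (Fin.cons X Γ : Fin (n + 1) → QSet.{u, v})) (a := consAt i a)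
      (bijective_sumElim_zero_succ n) fun ξ _ η hη => ?_
    exact (hQ a η).1 hη i ξ

theorem interp_atomic₂ {p q : Fin n} (hpq : p ≠ q)
    (B : ∀ (i : (Γ p).At) (j : (Γ q).At),
      Submodule ℂ ((Γ p).atom i →ₗ[ℂ] (Γ q).atom j →ₗ[ℂ] ℂ)) {K : Type} {t : K → Fin n}
    (hst : Function.Bijective (Sum.elim ![p, q] t)) :
    (atomic₂ p q hpq B).interp =
      Rel.prod ![p, q] t (Rel.ofBilin (Γ := fun k => Γ (![p, q] k)) B) ⊤ :=
  prod_top_congr (bijective_sumElim_compl (⟨![p, q], _⟩ : Fin 2 ↪ Fin n)) hst _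

/-- When the antecedent involves only the variables in `s`, projecting to it changes only the factor
in those variables. -/
theorem tmul_mem_interp_imp_iff {J K : Type} [Fintype J] [Fintype K] [DecidableEq J]
    [DecidableEq K] {s : J → Fin n} {t : K → Fin n} (hst : Function.Bijective (Sum.elim s t))
    {φ ψ : Formula Γ} {P : Rel fun j => Γ (s j)} (hφ : φ.interp = Rel.prod s t P ⊤)
    {a : ∀ k, (Γ k).At} {ξ p : Functional (fun j => Γ (s j)) fun j => a (s j)} (hp : p ∈ P _)
    (hξ : ξ - p ∈ (P _)ᗮ) (η : Functional (fun k => Γ (t k)) fun k => a (t k)) :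
    tmul hst ξ η ∈ (φ.imp ψ).interp a ↔ tmul hst p η ∈ ψ.interp a := by
  apply mem_interp_imp_iff
  · rw [hφ]
    exact tmul_mem_prod hst hp trivial
  · rw [hφ, ← tmul_sub_left]
    exact tmul_mem_prod_orthogonal_left hst ⊤ hξ η

section Bilinear

variable {K : Type} [Fintype K] [DecidableEq K] {s : Fin 2 → Fin n} {t : K → Fin n}
  (hst : Function.Bijective (Sum.elim s t)) {φ ψ : Formula Γ}
  {B : ∀ (i : (Γ (s 0)).At) (j : (Γ (s 1)).At),
    Submodule ℂ ((Γ (s 0)).atom i →ₗ[ℂ] (Γ (s 1)).atom j →ₗ[ℂ] ℂ)}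
  {a : ∀ k, (Γ k).At}

theorem tmul_mem_interp_imp_of_eq_bot
    (hφ : φ.interp = Rel.prod s t (Rel.ofBilin (Γ := fun k => Γ (s k)) B) ⊤)
    (η : Functional (fun k => Γ (t k)) fun k => a (t k))
    (hB : ∀ β ∈ B (a (s 0)) (a (s 1)), β = 0)
    (ξ : Functional (fun j => Γ (s j)) fun j => a (s j)) :
    tmul hst ξ η ∈ (φ.imp ψ).interp a := by
  have hP : Rel.ofBilin (Γ := fun k => Γ (s k)) B (fun k => a (s k)) = ⊥ := by
    rw [eq_bot_iff]
    intro μ hμ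
    obtain ⟨β, hβ, rfl⟩ := (mem_ofBilin_iff _ _).1 hμ
    rw [hB β hβ]
    rfl
  -- The projection to the zero subspace is `0`; writing it as `0 • 0` lets the scalar be pulled out
  -- of the product.
  rw [tmul_mem_interp_imp_iff hst hφ (p := 0) (zero_mem _) (by rw [hP]; simp),
    ← zero_smul ℂ (0 : Functional _ _), tmul_smul_left, zero_smul]
  exact zero_mem _

/-- Projecting `ξ ⊗ ζ` to the line spanned by `ε` gives a multiple of `ε`, and for some `ξ` and `ζ`
the coefficient is nonzero. All these memberships together thus reduce to the one for `ε` itself. -/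
theorem forall_tmul_mem_interp_imp_iff
    (hφ : φ.interp = Rel.prod s t (Rel.ofBilin (Γ := fun k => Γ (s k)) B) ⊤)
    (η : Functional (fun k => Γ (t k)) fun k => a (t k))
    {ε : (Γ (s 0)).atom (a (s 0)) →ₗ[ℂ] (Γ (s 1)).atom (a (s 1)) →ₗ[ℂ] ℂ} (hε : ε ≠ 0)
    (hB : ∀ β, β ∈ B (a (s 0)) (a (s 1)) ↔ ∃ c : ℂ, c • ε = β) :
    (∀ ξ ζ, tmul hst (tmul (Γ := fun k => Γ (s k)) (a := fun k => a (s k))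
      bijective_sumElim_zero_one ξ ζ) η ∈ (φ.imp ψ).interp a) ↔
      tmul hst (bilinFunctional (Γ := fun k => Γ (s k)) (a := fun k => a (s k)) ε) η ∈
        ψ.interp a := by
  let ε' : Functional (fun k => Γ (s k)) fun k => a (s k) :=
    bilinFunctional (Γ := fun k => Γ (s k)) (a := fun k => a (s k)) ε
  have hP : Rel.ofBilin (Γ := fun k => Γ (s k)) B (fun k => a (s k)) = ℂ ∙ ε' := by
    ext μ
    rw [mem_ofBilin_iff, Submodule.mem_span_singleton]
    simp only [hB]
    constructor
    · rintro ⟨_, ⟨c, rfl⟩, rfl⟩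
      exact ⟨c, rfl⟩
    · rintro ⟨c, rfl⟩
      exact ⟨_, ⟨c, rfl⟩, rfl⟩
  have hε' : ε' ≠ 0 := fun h =>
    hε (bilinFunctional_injective (Γ := fun k => Γ (s k)) (a := fun k => a (s k)) (a₂ := 0) h)
  have key (ξ) : ∃ c : ℂ, inner ℂ ε' ξ = c * inner ℂ ε' ε' ∧
      (tmul hst ξ η ∈ (φ.imp ψ).interp a ↔ c • tmul hst ε' η ∈ ψ.interp a) := by
    obtain ⟨p, hp, r, hr, rfl⟩ := (Rel.ofBilin (Γ := fun k => Γ (s k)) B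
      (fun k => a (s k))).exists_add_mem_mem_orthogonal ξ
    have hp' := hp
    rw [hP, Submodule.mem_span_singleton] at hp'
    obtain ⟨c, rfl⟩ := hp'
    refine ⟨c, ?_, ?_⟩
    · rw [inner_add_right, inner_smul_right, hr ε'
        (hP.symm ▸ Submodule.mem_span_singleton_self _), add_zero]
    · rw [tmul_mem_interp_imp_iff hst hφ hp (by rw [add_sub_cancel_left]; exact hr),
        tmul_smul_left]
  constructor
  · intro h
    obtain ⟨ξ, ζ, hne⟩ := exists_inner_tmul_ne_zero hε'
    obtain ⟨c, hc, hiff⟩ := key (tmul bijective_sumElim_zero_one ξ ζ)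
    have hc0 : c ≠ 0 := by
      rintro rfl
      exact hne (hc.trans (zero_mul _))
    exact (Submodule.smul_mem_iff _ hc0).1 (hiff.1 (h ξ ζ))
  · intro h ξ ζ
    obtain ⟨c, -, hiff⟩ := key (tmul bijective_sumElim_zero_one ξ ζ)
    exact hiff.2 (Submodule.smul_mem _ c h)

end Bilinear

end Formula

/-- The context `(x, x*, …)`. -/
abbrev diagContext (X : QSet.{u, v}) (Γ : Fin n → QSet.{u, v}) : Fin (n + 2) → QSet.{u, v} :=
  Fin.cons X (Fin.cons X.dual Γ : Fin (n + 1) → QSet.{u, v})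

/-- The choice of atoms for the context `(x, x*, …)` that puts an atom and its dual first. -/
abbrev diagAt {X : QSet.{u, v}} (j : X.dual.At) (a : ∀ k, (Γ k).At) :
    ∀ k, (diagContext X Γ k).At :=
  consAt (X.ofDual j) (consAt j a)

/-- The product of the evaluation functional of an atom with a functional in the given context. -/
abbrev evalMul {X : QSet.{u, v}} (j : X.dual.At) {a : ∀ k, (Γ k).At} (η : Functional Γ a) :
    Functional (diagContext X Γ) (diagAt j a) :=
  tmul (Γ := diagContext X Γ) (a := diagAt j a) (bijective_sumElim_succ_succ n)
    (bilinFunctional (Γ := fun k => diagContext X Γ (![(0 : Fin (n + 2)), Fin.succ 0] k))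
      (a := fun k => diagAt j a (![(0 : Fin (n + 2)), Fin.succ 0] k)) (evalForm X j)) η

theorem evalForm_ne_zero (X : QSet.{u, v}) (i : X.dual.At) : evalForm X i ≠ 0 := by
  intro h
  obtain ⟨x, hx⟩ := exists_ne (0 : X.atom (X.ofDual i))
  have h' : InnerProductSpace.toDual ℂ (X.atom (X.ofDual i)) x x = 0 :=
    congrArg (fun β : X.atom (X.ofDual i) →ₗ[ℂ] X.dual.atom i →ₗ[ℂ] ℂ =>
      β x (InnerProductSpace.toDual ℂ (X.atom (X.ofDual i)) x)) h
  rw [InnerProductSpace.toDual_apply_apply, inner_self_eq_zero] at h'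
  exact hx h'

theorem mem_equality_iff (X : QSet.{u, v}) (j : X.dual.At)
    (β : X.atom (X.ofDual j) →ₗ[ℂ] X.dual.atom j →ₗ[ℂ] ℂ) :
    β ∈ equality X (X.ofDual j) j ↔ ∃ c : ℂ, c • evalForm X j = β := by
  rw [← Submodule.mem_span_singleton]
  suffices h : equality X (X.ofDual j) j = ℂ ∙ evalForm X j by rw [h]
  refine le_antisymm (Submodule.span_le.2 ?_)
    ((Submodule.span_singleton_le_iff_mem _ _).2 (Submodule.subset_span ⟨rfl, rfl⟩))
  rintro β ⟨h, rfl⟩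
  exact Submodule.mem_span_singleton_self _

theorem eq_zero_of_mem_equality (X : QSet.{u, v}) {i : X.At} {j : X.dual.At} (h : X.ofDual j ≠ i)
    (β : X.atom i →ₗ[ℂ] X.dual.atom j →ₗ[ℂ] ℂ) (hβ : β ∈ equality X i j) : β = 0 := by
  have h0 : equality X i j ≤ ⊥ := by
    refine Submodule.span_le.2 ?_
    rintro β ⟨h', -⟩
    exact absurd h' h
  exact (Submodule.mem_bot ℂ).1 (h0 hβ)

theorem consMul_consMul {X Y : QSet.{u, v}} {i : X.At} {j : Y.At} {a : ∀ k, (Γ k).At}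
    (ξ : Functional (fun _ : Unit => X) fun _ => i) (ζ : Functional (fun _ : Unit => Y) fun _ => j)
    (η : Functional Γ a) : consMul ξ (consMul ζ η) =
      tmul (Γ := (Fin.cons X (Fin.cons Y Γ : Fin (n + 1) → QSet.{u, v}) :
        Fin (n + 2) → QSet.{u, v})) (a := consAt i (consAt j a)) (bijective_sumElim_succ_succ n)
        (tmul (Γ := fun k => (Fin.cons X (Fin.cons Y Γ : Fin (n + 1) → QSet.{u, v}) :
            Fin (n + 2) → QSet.{u, v}) (![(0 : Fin (n + 2)), Fin.succ 0] k))
          (a := fun k => consAt i (consAt j a) (![(0 : Fin (n + 2)), Fin.succ 0] k))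
          bijective_sumElim_zero_one ξ ζ) η := by
  ext x
  exact (mul_assoc _ _ _).symm

/-- Two quantifiers test `φ` on products `ξ ⊗ ζ ⊗ η`. The antecedent `E_X` projects `ξ ⊗ ζ` to
multiples of `ε` on an atom and its dual, and to `0` on all other pairs of atoms. -/
theorem Formula.mem_interp_allDiag_iff (X : QSet.{u, v}) (φ : Formula (diagContext X Γ))
    {a : ∀ k, (Γ k).At} (η : Functional Γ a) :
    η ∈ (Formula.allDiag X φ).interp a ↔
      ∀ j : X.dual.At, evalMul j η ∈ φ.interp (diagAt j a) := by
  have hP := interp_atomic₂ (Γ := diagContext X Γ) (Fin.succ_ne_zero (0 : Fin (n + 1))).symm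
    (equality X) (bijective_sumElim_succ_succ n)
  have h₁ (j : X.dual.At) := forall_tmul_mem_interp_imp_iff (Γ := diagContext X Γ) (ψ := φ)
    (bijective_sumElim_succ_succ n) hP (a := diagAt j a) η (evalForm_ne_zero X j)
    (mem_equality_iff X j)
  rw [Formula.allDiag, mem_interp_all_iff]
  constructor
  · intro h j
    refine (h₁ j).1 fun ξ ζ => ?_
    exact (congrArg (· ∈ _) (consMul_consMul (X := X) (Y := X.dual) ξ ζ η)).mp
      ((mem_interp_all_iff X _ _).1 (h j ζ) (X.ofDual j) ξ)
  · intro h j ζ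
    refine (mem_interp_all_iff X _ _).2 fun i ξ => ?_
    refine (congrArg (· ∈ _) (consMul_consMul (X := X) (Y := X.dual) ξ ζ η)).mpr ?_
    by_cases hij : X.ofDual j = i
    · subst hij
      exact (h₁ j).2 (h j) ξ ζ
    · exact tmul_mem_interp_imp_of_eq_bot (Γ := diagContext X Γ) (bijective_sumElim_succ_succ n) hP
        (a := consAt i (consAt j a)) η (eq_zero_of_mem_equality X hij) _

end Quantifier

/-! ### Reflexivity and symmetry -/

section ConjTranspose

variable {Γ Γ' : Fin 2 → QSet.{u, v}} {a : ∀ k, (Γ k).At} {a' : ∀ k, (Γ' k).At}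

/-- A pair of vectors, as a dependent function. -/
def pairVec (y : (Γ 0).atom (a 0)) (z : (Γ 1).atom (a 1)) : ∀ k, (Γ k).atom (a k) :=
  Fin.cons (α := fun k => (Γ k).atom (a k)) y
    (Fin.cons (α := fun k : Fin 1 => (Γ k.succ).atom (a k.succ)) z finZeroElim)

theorem update_pairVec_zero (y y' : (Γ 0).atom (a 0)) (z : (Γ 1).atom (a 1)) :
    Function.update (pairVec y z) 0 y' = pairVec y' z :=
  Fin.update_cons_zero _ _ _

theorem update_pairVec_one (y : (Γ 0).atom (a 0)) (z z' : (Γ 1).atom (a 1)) :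
    Function.update (pairVec y z) 1 z' = pairVec y z' := by
  funext k
  obtain rfl | rfl : k = 0 ∨ k = 1 := by omega
  · rw [Function.update_of_ne (by decide)]
    rfl
  · rw [Function.update_self]
    rfl

/-- A functional of two variables, as a bilinear map. -/
def Functional.toBilin (ω : Functional Γ a) :
    (Γ 0).atom (a 0) →ₗ[ℂ] (Γ 1).atom (a 1) →ₗ[ℂ] ℂ :=
  LinearMap.mk₂ ℂ (fun y z => ω (pairVec y z))
    (fun y y' z => by
      rw [← update_pairVec_zero 0, ω.map_update_add, update_pairVec_zero, update_pairVec_zero])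
    (fun c y z => by
      rw [← update_pairVec_zero 0, ω.map_update_smul, update_pairVec_zero])
    (fun y z z' => by
      rw [← update_pairVec_one _ 0, ω.map_update_add, update_pairVec_one, update_pairVec_one])
    (fun c y z => by
      rw [← update_pairVec_one _ 0, ω.map_update_smul, update_pairVec_one])

/-- The conjugate transpose `(x, y) ↦ conj (ω (g y, f x))` of a functional `ω`, for conjugate-linear
maps `f` and `g`. -/
def conjTranspose (f : (Γ' 0).atom (a' 0) →ₗ⋆[ℂ] (Γ 1).atom (a 1))
    (g : (Γ' 1).atom (a' 1) →ₗ⋆[ℂ] (Γ 0).atom (a 0)) : Functional Γ a →ₗ⋆[ℂ] Functional Γ' a' where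
  toFun ω := bilinFunctional (LinearMap.mk₂ ℂ (fun x y => star (ω.toBilin (g y) (f x)))
    (fun x x' y => by simp) (fun c x y => by simp) (fun x y y' => by simp) (fun c x y => by simp))
  map_add' ω ω' := by
    ext x
    exact star_add (ω (pairVec _ _)) (ω' (pairVec _ _))
  map_smul' c ω := by
    ext x
    exact star_mul' c (ω (pairVec _ _))

theorem conjTranspose_apply (f : (Γ' 0).atom (a' 0) →ₗ⋆[ℂ] (Γ 1).atom (a 1))
    (g : (Γ' 1).atom (a' 1) →ₗ⋆[ℂ] (Γ 0).atom (a 0)) (ω : Functional Γ a)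
    (x : ∀ k, (Γ' k).atom (a' k)) :
    conjTranspose f g ω x = star (ω (pairVec (g (x 1)) (f (x 0)))) := rfl

theorem conjTranspose_bilinFunctional (f : (Γ' 0).atom (a' 0) →ₗ⋆[ℂ] (Γ 1).atom (a 1))
    (g : (Γ' 1).atom (a' 1) →ₗ⋆[ℂ] (Γ 0).atom (a 0))
    {β : (Γ 0).atom (a 0) →ₗ[ℂ] (Γ 1).atom (a 1) →ₗ[ℂ] ℂ}
    {β' : (Γ' 0).atom (a' 0) →ₗ[ℂ] (Γ' 1).atom (a' 1) →ₗ[ℂ] ℂ}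
    (h : ∀ x y, β' x y = star (β (g y) (f x))) :
    conjTranspose f g (bilinFunctional β) = bilinFunctional β' := by
  ext x
  exact (h _ _).symm

end ConjTranspose

section Inner

variable {I : Type} [Fintype I] [DecidableEq I] {Γ : I → QSet.{u, v}} {s t : Fin 2 → I}
  (hst : Function.Bijective (Sum.elim s t)) {a : ∀ k, (Γ k).At}

/-- The functional `v` pairs the variables crosswise: `t 0` with `s 1`, and `t 1` with `s 0`.
Contracting `v` with `ω` over a basis in the `s`-variables evaluates `ω` at `(g y, f x)`, up to
conjugation. -/
theorem inner_tmul_eq_inner_conjTranspose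
    (f : (Γ (t 0)).atom (a (t 0)) →ₗ⋆[ℂ] (Γ (s 1)).atom (a (s 1)))
    (g : (Γ (t 1)).atom (a (t 1)) →ₗ⋆[ℂ] (Γ (s 0)).atom (a (s 0))) {v : Functional Γ a}
    (hv : ∀ x, v x = inner ℂ (f (x (t 0))) (x (s 1)) * inner ℂ (g (x (t 1))) (x (s 0)))
    (ω : Functional (fun k => Γ (s k)) fun k => a (s k))
    (ζ : Functional (fun k => Γ (t k)) fun k => a (t k)) :
    inner ℂ (tmul hst ω ζ) v = inner ℂ ζ (conjTranspose (Γ := fun k => Γ (s k))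
      (a := fun k => a (s k)) (Γ' := fun k => Γ (t k)) (a' := fun k => a (t k)) f g ω) := by
  simp only [inner_functional, functionalInner, tmul_apply, conjTranspose_apply, hv]
  let E (k : I) (j : Fin (Module.finrank ℂ ((Γ k).atom (a k)))) : (Γ k).atom (a k) :=
    stdOrthonormalBasis ℂ ((Γ k).atom (a k)) j
  refine (sum_restrict hst (β := fun k => Fin (Module.finrank ℂ ((Γ k).atom (a k))))
    (fun c d => star ((ω fun k => E (s k) (c k)) * (ζ fun k => E (t k) (d k))) *
      (inner ℂ (f (E (t 0) (d 0))) (E (s 1) (c 1)) *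
        inner ℂ (g (E (t 1) (d 1))) (E (s 0) (c 0))))).trans ?_
  rw [Finset.sum_comm]
  refine Finset.sum_congr rfl fun d _ => ?_
  rw [ω.eval_eq_sum, star_sum, Finset.mul_sum]
  refine Finset.sum_congr rfl fun c _ => ?_
  rw [Fin.prod_univ_two, star_mul', star_mul', star_mul']
  have h₀ : star (inner ℂ (E (s 0) (c 0)) (g (E (t 1) (d 1)))) =
    inner ℂ (g (E (t 1) (d 1))) (E (s 0) (c 0)) := inner_conj_symm _ _
  have h₁ : star (inner ℂ (E (s 1) (c 1)) (f (E (t 0) (d 0)))) =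
    inner ℂ (f (E (t 0) (d 0))) (E (s 1) (c 1)) := inner_conj_symm _ _
  rw [← h₀, ← h₁]
  change _ = star (ζ fun k => E (t k) (d k)) * ((star (inner ℂ (E (s 0) (c 0))
    (g (E (t 1) (d 1)))) * star (inner ℂ (E (s 1) (c 1)) (f (E (t 0) (d 0))))) *
    star (ω fun k => E (s k) (c k)))
  ring

end Inner

theorem Formula.mem_interp_imp_iff_conjTranspose {n : ℕ} {Γ : Fin n → QSet.{u, v}}
    {s t : Fin 2 → Fin n} (hst : Function.Bijective (Sum.elim s t)) {a : ∀ k, (Γ k).At}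
    {φ ψ : Formula Γ} {P : Rel fun k => Γ (s k)} {Q : Rel fun k => Γ (t k)}
    (hφ : φ.interp = Rel.prod s t P ⊤) (hψ : ψ.interp = Rel.prod t s Q ⊤)
    (f : (Γ (t 0)).atom (a (t 0)) →ₗ⋆[ℂ] (Γ (s 1)).atom (a (s 1)))
    (g : (Γ (t 1)).atom (a (t 1)) →ₗ⋆[ℂ] (Γ (s 0)).atom (a (s 0))) {v : Functional Γ a}
    (hv : ∀ x, v x = inner ℂ (f (x (t 0))) (x (s 1)) * inner ℂ (g (x (t 1))) (x (s 0))) :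
    v ∈ (φ.imp ψ).interp a ↔ ∀ ω ∈ P fun k => a (s k),
      conjTranspose (Γ := fun k => Γ (s k)) (a := fun k => a (s k)) (Γ' := fun k => Γ (t k))
        (a' := fun k => a (t k)) f g ω ∈ Q fun k => a (t k) := by
  obtain ⟨p, hp, hvp, h⟩ := exists_projection_of_conjLinear hst P Q _ v
    (inner_tmul_eq_inner_conjTranspose hst f g hv)
  rw [← h, ← prod_swap, ← hψ]
  rw [← hφ] at hp hvp
  exact mem_interp_imp_iff φ ψ hp hvp

/-- Functionals of no variables are scalars, so the constant `1` spans them. -/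
theorem Formula.isTrue_iff (φ : Formula (![] : Fin 0 → QSet.{u, v})) :
    φ.IsTrue ↔ ∀ a, (MultilinearMap.constOfIsEmpty ℂ _ 1 :
      Functional (![] : Fin 0 → QSet.{u, v}) a) ∈ φ.interp a := by
  constructor
  · intro h a
    rw [show φ.interp = ⊤ from h]
    trivial
  · intro h
    refine top_le_iff.1 fun a η _ => ?_
    have e : η = η finZeroElim • (MultilinearMap.constOfIsEmpty ℂ _ 1 :
        Functional (![] : Fin 0 → QSet.{u, v}) a) := by
      ext x
      rw [Subsingleton.elim x finZeroElim]
      simp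
    rw [e]
    exact Submodule.smul_mem _ _ (h a)

/-! ### Bending operators into functionals, and the meaning of the two sentences -/

section BinRel

variable {X : QSet.{u, v}}

/-- The Riesz map from an atom to its dual. -/
def QSet.riesz (X : QSet.{u, v}) (j : X.dual.At) :
    X.atom (X.ofDual j) →ₗ⋆[ℂ] X.dual.atom j :=
  (InnerProductSpace.toDual ℂ (X.atom (X.ofDual j))).toLinearEquiv.toLinearMap

/-- The inverse of the Riesz map. -/
def QSet.rieszSymm (X : QSet.{u, v}) (j : X.dual.At) :
    X.dual.atom j →ₗ⋆[ℂ] X.atom (X.ofDual j) :=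
  (InnerProductSpace.toDual ℂ (X.atom (X.ofDual j))).symm.toLinearEquiv.toLinearMap

theorem inner_rieszSymm (j : X.dual.At) (φ : X.dual.atom j) (x : X.atom (X.ofDual j)) :
    inner ℂ (X.rieszSymm j φ) x = evalForm X j x φ :=
  InnerProductSpace.toDual_symm_apply

theorem inner_riesz (j : X.dual.At) (φ : X.dual.atom j) (x : X.atom (X.ofDual j)) :
    inner ℂ (X.riesz j x) φ = evalForm X j x φ := by
  refine Eq.trans ?_ (inner_rieszSymm j φ x)
  change inner ℂ (X.rieszSymm j φ) ((InnerProductSpace.toDual ℂ (X.atom (X.ofDual j))).symm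
    (InnerProductSpace.toDual ℂ (X.atom (X.ofDual j)) x)) = _
  rw [LinearIsometryEquiv.symm_apply_apply]

theorem evalForm_riesz (j : X.dual.At) (x y : X.atom (X.ofDual j)) :
    evalForm X j x (X.riesz j y) = inner ℂ y x := rfl

theorem bendForm_injective (i : X.At) (j : X.dual.At) :
    Function.Injective (bendForm (X := X) (Y := X) i j) := by
  intro r r' h
  ext x
  refine ext_inner_left ℂ fun y => ?_
  exact congrArg (fun β : X.atom i →ₗ[ℂ] X.dual.atom j →ₗ[ℂ] ℂ => β x (X.riesz j y)) h

theorem bendForm_mem_bend_iff (R : BinRel X X) (i : X.At) (j : X.dual.At)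
    (r : X.atom i →L[ℂ] X.atom (X.ofDual j)) :
    bendForm i j r ∈ bend R i j ↔ r ∈ R i (X.ofDual j) :=
  (bendForm_injective i j).mem_set_image

/-- By Riesz, `φ (r† x) = ⟪y, r† x⟫ = ⟪r y, x⟫`, where `y` represents `φ`. This matches
`conjTranspose` with `f` the Riesz map and `g` its inverse. -/
theorem bendForm_adjoint (j k : X.dual.At)
    (r : X.atom (X.ofDual j) →L[ℂ] X.atom (X.ofDual k)) (x : X.atom (X.ofDual k))
    (φ : X.dual.atom j) : bendForm (X.ofDual k) j (ContinuousLinearMap.adjoint r) x φ =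
      star (bendForm (X.ofDual j) k r (X.rieszSymm j φ) (X.riesz k x)) := by
  change evalForm X j (ContinuousLinearMap.adjoint r x) φ =
    star (evalForm X k (r (X.rieszSymm j φ)) (X.riesz k x))
  rw [evalForm_riesz, ← inner_rieszSymm, ContinuousLinearMap.adjoint_inner_right]
  exact (inner_conj_symm _ _).symm

theorem reflexivity_isTrue_iff (R : BinRel X X) :
    (reflexivity R).IsTrue ↔ ∀ i, 1 ∈ R i i := by
  have hP := Formula.interp_atomic₂ (Γ := diagContext X ![]) (p := 0) (q := 1) (by decide)
    (bend R) (bijective_sumElim_succ_succ 0)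
  have key (a) (j : X.dual.At) : evalMul j (MultilinearMap.constOfIsEmpty ℂ _ 1 :
        Functional (![] : Fin 0 → QSet.{u, v}) a) ∈ (Formula.atomic₂ (Γ := diagContext X ![]) 0 1
          (by decide) (bend R)).interp (diagAt j a) ↔ 1 ∈ R (X.ofDual j) (X.ofDual j) := by
    rw [hP]
    refine (tmul_mem_prod_top_iff (Γ := diagContext X ![]) (a := diagAt j a)
      (bijective_sumElim_succ_succ 0) _ ?_).trans ?_
    · intro h
      exact one_ne_zero (congrArg (fun η : Functional (![] : Fin 0 → QSet.{u, v}) a =>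
        η finZeroElim) h)
    · refine (bilinFunctional_mem_ofBilin_iff
        (Γ := fun k => diagContext X ![] (![(0 : Fin 2), Fin.succ 0] k))
        (a := fun k => diagAt j a (![(0 : Fin 2), Fin.succ 0] k))).trans ?_
      exact bendForm_mem_bend_iff R (X.ofDual j) j 1
  rw [Formula.isTrue_iff]
  constructor
  · intro h i
    exact (key finZeroElim i).1 ((Formula.mem_interp_allDiag_iff X _ _).1 (h finZeroElim) i)
  · intro h a
    exact (Formula.mem_interp_allDiag_iff X _ _).2 fun j => (key a j).2 (h _)

theorem symmetry_isTrue_iff (R : BinRel X X) :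
    (symmetry R).IsTrue ↔
      ∀ i j, ∀ r ∈ R i j, ContinuousLinearMap.adjoint r ∈ R j i := by
  let Δ : Fin 4 → QSet.{u, v} := diagContext X (diagContext X ![])
  -- In the context `(x₂, x₂*, x₁, x₁*)`, `s` selects `(x₁, x₂*)` for the antecedent and `t` selects
  -- `(x₂, x₁*)` for the consequent.
  let s : Fin 2 → Fin 4 := ![2, 1]
  let t : Fin 2 → Fin 4 := ![0, 3]
  have hst : Function.Bijective (Sum.elim s t) := by decide
  let φ : Formula Δ := .atomic₂ 2 1 (by decide) (bend R)
  let ψ : Formula Δ := .atomic₂ 0 3 (by decide) (bend R)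
  have hφ := Formula.interp_atomic₂ (Γ := Δ) (p := 2) (q := 1) (by decide) (bend R) hst
  have hψ := Formula.interp_atomic₂ (Γ := Δ) (p := 0) (q := 3) (by decide) (bend R)
    (bijective_sumElim_swap hst)
  have key (a) (j k : X.dual.At) : evalMul k (evalMul j (MultilinearMap.constOfIsEmpty ℂ _ 1 :
        Functional (![] : Fin 0 → QSet.{u, v}) a)) ∈ (φ.imp ψ).interp (diagAt k (diagAt j a)) ↔
      ∀ r ∈ R (X.ofDual j) (X.ofDual k),
        ContinuousLinearMap.adjoint r ∈ R (X.ofDual k) (X.ofDual j) := by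
    let b : ∀ l, (Δ l).At := diagAt k (diagAt j a)
    refine (Formula.mem_interp_imp_iff_conjTranspose (Γ := Δ) hst (a := b) hφ hψ (X.riesz k)
      (X.rieszSymm j) ?_).trans ?_
    · intro x
      -- The functional is `ε ⊗ ε ⊗ 1`; each `ε` is an inner product after moving one argument by
      -- the Riesz map, and `mul_one` removes the scalar factor.
      refine Eq.trans ?_ (congrArg₂ (· * ·) (inner_riesz k (x 1) (x 0)).symm
        (inner_rieszSymm j (x 3) (x 2)).symm)
      exact congrArg (fun z : ℂ => evalForm X k (x 0) (x 1) * z) (mul_one _)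
    · have hA (r : X.atom (X.ofDual j) →L[ℂ] X.atom (X.ofDual k)) :=
        conjTranspose_bilinFunctional (Γ := fun l => Δ (s l)) (a := fun l => b (s l))
          (Γ' := fun l => Δ (t l)) (a' := fun l => b (t l)) (X.riesz k) (X.rieszSymm j)
          (bendForm_adjoint j k r)
      constructor
      · intro h r hr
        refine (bendForm_mem_bend_iff R (X.ofDual k) j _).1 ?_
        refine (bilinFunctional_mem_ofBilin_iff (Γ := fun l => Δ (t l))
          (a := fun l => b (t l))).1 ?_
        refine (congrArg (· ∈ _) (hA r)).mp (h _ ?_)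
        exact (bilinFunctional_mem_ofBilin_iff (Γ := fun l => Δ (s l))
          (a := fun l => b (s l))).2 ((bendForm_mem_bend_iff R (X.ofDual j) k r).2 hr)
      · intro h ω hω
        obtain ⟨_, ⟨r, hr, rfl⟩, rfl⟩ := (mem_ofBilin_iff _ _).1 hω
        refine (congrArg (· ∈ _) (hA r)).mpr ?_
        exact (bilinFunctional_mem_ofBilin_iff (Γ := fun l => Δ (t l))
          (a := fun l => b (t l))).2 ((bendForm_mem_bend_iff R (X.ofDual k) j _).2 (h r hr))
  rw [Formula.isTrue_iff]
  constructor
  · intro h i j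
    exact (key finZeroElim i j).1 ((Formula.mem_interp_allDiag_iff X _ _).1
      ((Formula.mem_interp_allDiag_iff X _ _).1 (h finZeroElim) i) j)
  · intro h a
    exact (Formula.mem_interp_allDiag_iff X _ _).2 fun j =>
      (Formula.mem_interp_allDiag_iff X _ _).2 fun k => (key a j k).2 (h _ _)

end BinRel

/-! ### Quantum graphs on `ℓ∞(X)` -/

section Ultraweak

variable {H : Type*} [NormedAddCommGroup H] [InnerProductSpace ℂ H]

theorem continuous_ultraweak_tsum (x y : lp (fun _ : ℕ => H) 2) :
    Continuous[ultraweak H, inferInstance] fun T : H →L[ℂ] H =>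
      ∑' k, inner ℂ (x k) (T (y k)) :=
  continuous_iff_le_induced.2 (iInf_le (fun p : lp (fun _ : ℕ => H) 2 × lp (fun _ : ℕ => H) 2 =>
    TopologicalSpace.induced (fun T : H →L[ℂ] H => ∑' k, inner ℂ (p.1 k) (T (p.2 k)))
      inferInstance) (x, y))

/-- A matrix coefficient is the ultraweak functional of two sequences concentrated at index `0`. -/
theorem continuous_ultraweak_inner (x y : H) :
    Continuous[ultraweak H, inferInstance] fun T : H →L[ℂ] H => inner ℂ x (T y) := by
  have h := continuous_ultraweak_tsum (lp.single 2 0 x : lp (fun _ : ℕ => H) 2)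
    (lp.single 2 0 y : lp (fun _ : ℕ => H) 2)
  convert h using 2 with T
  rw [tsum_eq_single 0]
  · simp
  · intro k hk
    simp [hk]

theorem tendsto_ultraweak {ι : Type*} {l : Filter ι} {f : ι → H →L[ℂ] H} {T : H →L[ℂ] H}
    (h : ∀ x y : lp (fun _ : ℕ => H) 2, Filter.Tendsto (fun i => ∑' k, inner ℂ (x k) (f i (y k))) l
      (𝓝 (∑' k, inner ℂ (x k) (T (y k))))) :
    Filter.Tendsto f l (@nhds _ (ultraweak H) T) := by
  rw [nhds_iInf, Filter.tendsto_iInf]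
  rintro ⟨x, y⟩
  rw [nhds_induced, Filter.tendsto_comap_iff]
  exact h x y

end Ultraweak

theorem eq_sum_matrixUnits {E F ι κ : Type*} [NormedAddCommGroup E] [InnerProductSpace ℂ E]
    [NormedAddCommGroup F] [InnerProductSpace ℂ F] [Fintype ι] [Fintype κ]
    (e : OrthonormalBasis ι ℂ E) (f : OrthonormalBasis κ ℂ F) (r : E →L[ℂ] F) :
    r = ∑ k, ∑ l, (inner ℂ (f l) (r (e k)) : ℂ) • (innerSL ℂ (e k)).smulRight (f l) := by
  ext x
  conv_lhs => rw [← e.sum_repr' x]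
  simp only [map_sum, map_smul, sum_apply, smul_apply, ContinuousLinearMap.smulRight_apply,
    innerSL_apply_apply]
  refine Finset.sum_congr rfl fun k _ => ?_
  conv_lhs => rw [← f.sum_repr' (r (e k))]
  rw [Finset.smul_sum]
  exact Finset.sum_congr rfl fun l _ => smul_comm _ _ _

/-! ### Corners, the commutant of `ℓ∞(X)`, and the inverse construction -/

namespace QSet

variable (X : QSet.{u, v})

theorem inc_apply_self (i : X.At) (x : X.atom i) : X.inc i x i = x := by
  classical
  simp [inc]

theorem inc_apply_of_ne {i j : X.At} (h : j ≠ i) (x : X.atom i) : X.inc i x j = 0 := by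
  classical
  simp [inc, h]

theorem adjoint_inc_comp_inc_self (i : X.At) :
    ContinuousLinearMap.adjoint (X.inc i) ∘L X.inc i = 1 := by
  ext x
  rw [ContinuousLinearMap.comp_apply, inc_adjoint_apply, inc_apply_self]
  rfl

theorem adjoint_inc_comp_inc_of_ne {i j : X.At} (h : j ≠ i) :
    ContinuousLinearMap.adjoint (X.inc j) ∘L X.inc i = 0 := by
  ext x
  rw [ContinuousLinearMap.comp_apply, inc_adjoint_apply, inc_apply_of_ne X h]
  rfl

/-- The orthogonal projection to an atom. -/
def proj (i : X.At) : X.hilbertSum →L[ℂ] X.hilbertSum :=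
  X.inc i ∘L ContinuousLinearMap.adjoint (X.inc i)

theorem proj_apply (i : X.At) (w : X.hilbertSum) : X.proj i w = X.inc i (w i) := by
  rw [proj, ContinuousLinearMap.comp_apply, inc_adjoint_apply]

theorem inner_proj (i : X.At) (w z : X.hilbertSum) :
    inner ℂ (X.proj i w) z = inner ℂ w (X.proj i z) := by
  simp only [proj, ContinuousLinearMap.comp_apply]
  rw [← ContinuousLinearMap.adjoint_inner_right, ContinuousLinearMap.adjoint_inner_left]

theorem proj_mem_commutant (i : X.At) : X.proj i ∈ X.ellInfty.commutant := by
  rw [VonNeumannAlgebra.mem_commutant_iff]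
  rintro S ⟨a, ha⟩
  ext w j
  simp only [mul_apply_eq_comp, proj_apply, ha]
  by_cases hj : j = i
  · subst hj
    simp only [inc_apply_self]
  · simp only [inc_apply_of_ne X hj, map_zero]

theorem corner_mem_ellInfty (i : X.At) (b : X.atom i →L[ℂ] X.atom i) :
    X.inc i ∘L b ∘L ContinuousLinearMap.adjoint (X.inc i) ∈ X.ellInfty := by
  classical
  refine ⟨lp.single ∞ i b, fun w j => ?_⟩
  simp only [ContinuousLinearMap.comp_apply, inc_adjoint_apply]
  by_cases hj : j = i
  · subst hj
    rw [inc_apply_self, lp.single_apply_self]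
  · rw [inc_apply_of_ne X hj, lp.single_apply_ne _ _ _ hj]
    rfl

/-- An element of the commutant commutes with all of `L(X_i)` placed in the corner at `i`, in
particular with rank-one operators, so it acts there as a scalar. -/
theorem exists_smul_of_mem_commutant {m : X.hilbertSum →L[ℂ] X.hilbertSum}
    (hm : m ∈ X.ellInfty.commutant) (i : X.At) :
    ∃ c : ℂ, m ∘L X.inc i = c • X.inc i ∧
      ContinuousLinearMap.adjoint (X.inc i) ∘L m = c • ContinuousLinearMap.adjoint (X.inc i) := by
  have hcomm (b : X.atom i →L[ℂ] X.atom i) (w : X.hilbertSum) :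
      X.inc i (b (m w i)) = m (X.inc i (b (w i))) := by
    have h := congrArg (fun S : X.hilbertSum →L[ℂ] X.hilbertSum => S w)
      (VonNeumannAlgebra.mem_commutant_iff.1 hm _ (X.corner_mem_ellInfty i b))
    simpa only [mul_apply_eq_comp, ContinuousLinearMap.comp_apply, inc_adjoint_apply]
      using h
  obtain ⟨e, he⟩ := exists_ne (0 : X.atom i)
  have he' : inner ℂ e e ≠ (0 : ℂ) := inner_self_ne_zero.2 he
  let c : ℂ := inner ℂ e (m (X.inc i e) i) / inner ℂ e e
  have h₁ (x : X.atom i) : m (X.inc i x) = c • X.inc i x := by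
    -- The rank-one operator that sends `e` to `x`; commuting with it forces the scalar found at `e`
    -- to be the scalar at `x`.
    let b : X.atom i →L[ℂ] X.atom i := (inner ℂ e e : ℂ)⁻¹ • (innerSL ℂ e).smulRight x
    have hb (y : X.atom i) : b y = (inner ℂ e y / inner ℂ e e : ℂ) • x := by
      simp [b, smul_smul, div_eq_inv_mul]
    have h := hcomm b (X.inc i e)
    rw [inc_apply_self, hb, hb, div_self he', one_smul, map_smul] at h
    exact h.symm
  refine ⟨c, ContinuousLinearMap.ext h₁, ?_⟩
  ext w
  simp only [ContinuousLinearMap.comp_apply, inc_adjoint_apply, smul_apply]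
  have h := congrArg (fun z : X.hilbertSum => z i) (hcomm 1 w)
  simpa [h₁, inc_apply_self] using h

/-- The space of operators whose corners belong to a binary relation. -/
def ofBinRel (R : BinRel X X) : Submodule ℂ (X.hilbertSum →L[ℂ] X.hilbertSum) where
  carrier := {T | ∀ i j, ContinuousLinearMap.adjoint (X.inc j) ∘L T ∘L X.inc i ∈ R i j}
  zero_mem' i j := by simp
  add_mem' hS hT i j := by
    simpa using add_mem (hS i j) (hT i j)
  smul_mem' c T hT i j := by
    simpa using Submodule.smul_mem _ c (hT i j)

theorem mem_ofBinRel {R : BinRel X X} {T : X.hilbertSum →L[ℂ] X.hilbertSum} :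
    T ∈ X.ofBinRel R ↔
      ∀ i j, ContinuousLinearMap.adjoint (X.inc j) ∘L T ∘L X.inc i ∈ R i j := Iff.rfl

theorem toBinRel_ofBinRel (R : BinRel X X) : X.toBinRel (X.ofBinRel R) = R := by
  funext i j
  ext r
  constructor
  · rintro ⟨T, hT, rfl⟩
    exact hT i j
  · intro hr
    -- Placing `r` in the corner `(i, j)` makes every other corner zero.
    refine ⟨X.inc j ∘L r ∘L ContinuousLinearMap.adjoint (X.inc i), fun k l => ?_, ?_⟩
    · by_cases hl : l = j
      · by_cases hk : k = i
        · subst hl hk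
          convert hr
          ext x
          simp [inc_adjoint_apply, inc_apply_self]
        · convert zero_mem (R k l)
          ext x
          simp [inc_adjoint_apply, inc_apply_of_ne X (Ne.symm hk)]
      · convert zero_mem (R k l)
        ext x
        simp [inc_adjoint_apply, inc_apply_of_ne X hl]
    · ext x
      simp [inc_adjoint_apply, inc_apply_self]

/-- Each corner is a finite combination of fixed operators whose coefficients are matrix
coefficients of `T`, hence ultraweakly continuous; subspaces of the finite-dimensional target are
closed. -/
theorem isClosed_ofBinRel (R : BinRel X X) :
    IsClosed[ultraweak X.hilbertSum] (X.ofBinRel R : Set (X.hilbertSum →L[ℂ] X.hilbertSum)) := by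
  let _ := ultraweak X.hilbertSum
  have hcorner (i j : X.At) : Continuous fun T : X.hilbertSum →L[ℂ] X.hilbertSum =>
      ContinuousLinearMap.adjoint (X.inc j) ∘L T ∘L X.inc i := by
    have e (T : X.hilbertSum →L[ℂ] X.hilbertSum) :
        ContinuousLinearMap.adjoint (X.inc j) ∘L T ∘L X.inc i = ∑ k, ∑ l,
          (inner ℂ (X.inc j (stdOrthonormalBasis ℂ (X.atom j) l))
            (T (X.inc i (stdOrthonormalBasis ℂ (X.atom i) k))) : ℂ) •
            (innerSL ℂ (stdOrthonormalBasis ℂ (X.atom i) k)).smulRight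
              (stdOrthonormalBasis ℂ (X.atom j) l) :=
      eq_sum_matrixUnits (stdOrthonormalBasis ℂ (X.atom i)) (stdOrthonormalBasis ℂ (X.atom j)) _
        |>.trans (by simp only [ContinuousLinearMap.comp_apply,
          ContinuousLinearMap.adjoint_inner_right])
    simp only [e]
    exact continuous_finsetSum _ fun k _ => continuous_finsetSum _ fun l _ =>
      (continuous_ultraweak_inner _ _).smul continuous_const
  have h : (X.ofBinRel R : Set (X.hilbertSum →L[ℂ] X.hilbertSum)) = ⋂ i, ⋂ j,
      (fun T : X.hilbertSum →L[ℂ] X.hilbertSum =>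
        ContinuousLinearMap.adjoint (X.inc j) ∘L T ∘L X.inc i) ⁻¹' (R i j : Set _) := by
    ext T
    simp [mem_ofBinRel]
  rw [h]
  exact isClosed_iInter fun i => isClosed_iInter fun j =>
    (R i j).closed_of_finiteDimensional.preimage (hcorner i j)

theorem isQuantumGraph_ofBinRel {R : BinRel X X} (h₁ : ∀ i, 1 ∈ R i i)
    (h₂ : ∀ i j, ∀ r ∈ R i j, ContinuousLinearMap.adjoint r ∈ R j i) :
    IsQuantumGraph X.ellInfty (X.ofBinRel R) where
  isOperatorSystem :=
    { one_mem := fun i j => by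
        by_cases h : j = i
        · subst h
          change ContinuousLinearMap.adjoint (X.inc j) ∘L X.inc j ∈ R j j
          rw [adjoint_inc_comp_inc_self]
          exact h₁ j
        · change ContinuousLinearMap.adjoint (X.inc j) ∘L X.inc i ∈ R i j
          rw [adjoint_inc_comp_inc_of_ne X h]
          exact zero_mem _
      adjoint_mem := fun T hT i j => by
        have h := h₂ _ _ _ (hT j i)
        rwa [ContinuousLinearMap.adjoint_comp, ContinuousLinearMap.adjoint_comp,
          ContinuousLinearMap.adjoint_adjoint, ContinuousLinearMap.comp_assoc] at h }
  isClosed := X.isClosed_ofBinRel R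
  mul_mem_left m hm T hT i j := by
    obtain ⟨c, -, hc⟩ := X.exists_smul_of_mem_commutant hm j
    change (ContinuousLinearMap.adjoint (X.inc j) ∘L m) ∘L T ∘L X.inc i ∈ R i j
    rw [hc, ContinuousLinearMap.smul_comp]
    exact Submodule.smul_mem _ c (hT i j)
  mul_mem_right m hm T hT i j := by
    obtain ⟨c, hc, -⟩ := X.exists_smul_of_mem_commutant hm i
    change ContinuousLinearMap.adjoint (X.inc j) ∘L T ∘L m ∘L X.inc i ∈ R i j
    rw [hc, ContinuousLinearMap.comp_smul, ContinuousLinearMap.comp_smul]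
    exact Submodule.smul_mem _ c (hT i j)

/-! ### Ultraweak approximation by finitely many atoms -/

theorem tendsto_sum_proj (w : X.hilbertSum) :
    Filter.Tendsto (fun F : Finset X.At => (∑ i ∈ F, X.proj i) w) Filter.atTop (𝓝 w) := by
  classical
  have h := lp.hasSum_single (p := 2) (by simp) w
  refine Filter.Tendsto.congr (fun F => ?_) h
  simp only [sum_apply, proj_apply]
  rfl

theorem norm_sum_proj_apply_le (F : Finset X.At) (w : X.hilbertSum) :
    ‖(∑ i ∈ F, X.proj i) w‖ ≤ ‖w‖ := by
  classical
  have e : (∑ i ∈ F, X.proj i) w = ∑ i ∈ F, lp.single 2 i (w i) := by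
    simp only [sum_apply, proj_apply]
    rfl
  rw [e]
  refine (Real.rpow_le_rpow_iff (norm_nonneg _) (norm_nonneg _) (z := 2) (by norm_num)).1 ?_
  have h₁ := lp.norm_sum_single (E := X.atom) (p := 2) (by norm_num) w F
  have h₂ := lp.sum_rpow_le_norm_rpow (E := X.atom) (p := 2) (by norm_num) w F
  rw [ENNReal.toReal_ofNat] at h₁ h₂
  exact h₁.trans_le h₂

/-- The finite truncations are self-adjoint contractions converging strongly to the identity. Each
term of an ultraweak functional converges, and dominated convergence handles the series. -/
theorem tendsto_compress (T : X.hilbertSum →L[ℂ] X.hilbertSum) :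
    Filter.Tendsto (fun F : Finset X.At => (∑ i ∈ F, X.proj i) * T * (∑ i ∈ F, X.proj i))
      Filter.atTop (@nhds _ (ultraweak X.hilbertSum) T) := by
  refine tendsto_ultraweak fun x y => ?_
  have hself (F : Finset X.At) (w z : X.hilbertSum) :
      inner ℂ w ((∑ i ∈ F, X.proj i) z) = inner ℂ ((∑ i ∈ F, X.proj i) w) z := by
    simp only [sum_apply, inner_sum, sum_inner, inner_proj]
  refine tendsto_tsum_of_dominated_convergence (bound := fun k => ‖T‖ * (‖x k‖ * ‖y k‖)) ?_ ?_ ?_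
  · have hx := (lp.memℓp x).summable (by norm_num)
    have hy := (lp.memℓp y).summable (by norm_num)
    simp only [ENNReal.toReal_ofNat, Real.rpow_ofNat] at hx hy
    refine (Summable.of_nonneg_of_le (fun k => by positivity) (fun k => ?_)
      (hx.add hy)).mul_left _
    -- The product of two square-summable sequences of norms is dominated by the sum of their
    -- squares.
    nlinarith [sq_nonneg (‖x k‖ - ‖y k‖), sq_nonneg ‖x k‖, sq_nonneg ‖y k‖]
  · intro k
    simp only [mul_apply_eq_comp, hself]
    exact (X.tendsto_sum_proj (x k)).inner ((T.continuous.tendsto _).comp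
      (X.tendsto_sum_proj (y k)))
  · refine Filter.Eventually.of_forall fun F k => ?_
    simp only [mul_apply_eq_comp, hself]
    calc _ ≤ ‖x k‖ * (‖T‖ * ‖y k‖) := (norm_inner_le_norm _ _).trans
          (mul_le_mul (X.norm_sum_proj_apply_le F _) ((T.le_opNorm _).trans
            (mul_le_mul_of_nonneg_left (X.norm_sum_proj_apply_le F _) (norm_nonneg _)))
            (norm_nonneg _) (norm_nonneg _))
      _ = _ := by ring

theorem ofBinRel_toBinRel {V : Submodule ℂ (X.hilbertSum →L[ℂ] X.hilbertSum)}
    (hV : IsQuantumGraph X.ellInfty V) : X.ofBinRel (X.toBinRel V) = V := by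
  refine le_antisymm (fun T hT => ?_) fun T hT i j => ⟨T, hT, rfl⟩
  have hmem (F : Finset X.At) : (∑ i ∈ F, X.proj i) * T * (∑ i ∈ F, X.proj i) ∈ V := by
    simp only [Finset.sum_mul, Finset.mul_sum]
    refine sum_mem fun i _ => sum_mem fun j _ => ?_
    obtain ⟨S, hS, h⟩ := hT i j
    -- A block of `T` depends only on its corner, which is also a corner of some `S ∈ V`; the
    -- bimodule property puts that block of `S` in `V`.
    have e : X.proj j * T * X.proj i = X.proj j * S * X.proj i := by
      change X.inc j ∘L (ContinuousLinearMap.adjoint (X.inc j) ∘L T ∘L X.inc i) ∘L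
        ContinuousLinearMap.adjoint (X.inc i) = X.inc j ∘L (ContinuousLinearMap.adjoint (X.inc j)
          ∘L S ∘L X.inc i) ∘L ContinuousLinearMap.adjoint (X.inc i)
      rw [h]
    rw [e]
    exact hV.mul_mem_right _ (X.proj_mem_commutant i) _
      (hV.mul_mem_left _ (X.proj_mem_commutant j) _ hS)
  let _ := ultraweak X.hilbertSum
  exact hV.isClosed.mem_of_tendsto (X.tendsto_compress T) (Filter.Eventually.of_forall hmem)

theorem one_mem_toBinRel {V : Submodule ℂ (X.hilbertSum →L[ℂ] X.hilbertSum)}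
    (hV : IsOperatorSystem V) (i : X.At) : 1 ∈ X.toBinRel V i i :=
  ⟨1, hV.one_mem, X.adjoint_inc_comp_inc_self i⟩

theorem adjoint_mem_toBinRel {V : Submodule ℂ (X.hilbertSum →L[ℂ] X.hilbertSum)}
    (hV : IsOperatorSystem V) (i j : X.At) (r : X.atom i →L[ℂ] X.atom j)
    (hr : r ∈ X.toBinRel V i j) : ContinuousLinearMap.adjoint r ∈ X.toBinRel V j i := by
  obtain ⟨T, hT, rfl⟩ := hr
  refine ⟨ContinuousLinearMap.adjoint T, hV.adjoint_mem T hT, ?_⟩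
  rw [ContinuousLinearMap.adjoint_comp, ContinuousLinearMap.adjoint_comp,
    ContinuousLinearMap.adjoint_adjoint, ContinuousLinearMap.comp_assoc]

end QSet

end QuantumLogic

end

/-! ### The two correspondences -/

theorem mainTheorem4 (X : QuantumLogic.QSet.{u, v}) :
    Set.BijOn X.toBinRel
      {V | QuantumLogic.IsQuantumGraph X.ellInfty V}
      {R | (QuantumLogic.reflexivity R).IsTrue ∧ (QuantumLogic.symmetry R).IsTrue} ∧
    ∀ h : X.At, (∀ i : X.At, i = h) →
      Set.BijOn (fun R : QuantumLogic.BinRel X X => R h h)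
        {R | (QuantumLogic.reflexivity R).IsTrue ∧ (QuantumLogic.symmetry R).IsTrue}
        {V | QuantumLogic.IsOperatorSystem V} := by
  simp only [QuantumLogic.reflexivity_isTrue_iff, QuantumLogic.symmetry_isTrue_iff]
  refine ⟨⟨fun V hV => ⟨X.one_mem_toBinRel hV.isOperatorSystem,
    X.adjoint_mem_toBinRel hV.isOperatorSystem⟩, fun V hV W hW h => ?_, fun R hR =>
    ⟨X.ofBinRel R, X.isQuantumGraph_ofBinRel hR.1 hR.2, X.toBinRel_ofBinRel R⟩⟩,
    fun h hX => ⟨fun R hR => ⟨hR.1 h, hR.2 h h⟩, fun R _ R' _ e => ?_, fun V hV => ?_⟩⟩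
  · rw [← X.ofBinRel_toBinRel hV, h, X.ofBinRel_toBinRel hW]
  · funext i j
    obtain rfl := hX i
    obtain rfl := hX j
    exact e
  -- As all labels equal `h`, `V` is transported to every pair of labels; at `(h, h)` the transport
  -- is trivial.
  · obtain ⟨R, rfl⟩ : ∃ R : QuantumLogic.BinRel X X, R h h = V :=
      ⟨fun i j => (hX i).symm ▸ (hX j).symm ▸ V, rfl⟩
    refine ⟨R, ⟨fun i => ?_, fun i j => ?_⟩, rfl⟩
    · obtain rfl := hX i
      exact hV.one_mem
    · obtain rfl := hX i
      obtain rfl := hX j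
      exact hV.adjoint_mem
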